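/- \textbf{Setting.} Fix a term algebra: expressions are built from values, variables and interpreted operators; an action term is $a(e_1,\dots,e_n)$ with $a$ a label, and $\tau$ is a distinguished action term without arguments. The signature of an action term is its label together with its arity. A \emph{pLTS} is a transition system with a set of variables $V$ whose transitions are labelled $\langle\alpha,e_b,(x_j:=e_j)_j\rangle$, with an action $\alpha$ (whose parameters are input variables $?x$ or expressions over $V$), a guard $e_b$, and a parallel assignment of variables of $V$. A \emph{pNet} is a pLTS or a node $\langle\langle P_i^{i\in I},\mathrm{Sort}_j^{j\in J},SV_k^{k\in K}\rangle\rangle$ with sub-pNets $P_i$ (having pairwise disjoint variables and hole indexes), holes $j\in J$ with sorts $\mathrm{Sort}_j$ (sets of action signatures), and synchronisation vectors $\alpha_l^{\,l\in I_k\uplus J_k}\to\alpha'\,[e]$, $I_k\subseteq I$, $J_k\subseteq J$, whose components $\alpha_l$ belong to the sort of the corresponding sub-pNet or hole and contain all variables of $\alpha'$ and of the guard $e$. The sort $\mathrm{Sort}(P)$ of a pNet is the set of signatures of its pLTS actions, respectively of the global actions $\alpha'$ of its top-level vectors. For $j_0\in J$, $P[Q]_{j_0}$ is the node in which the hole $j_0$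 is replaced by the sub-pNet $Q$. \textbf{Semantics.} The semantics of $P$ is the open automaton whose states are the tuples of states of its pLTS leaves, and whose open transitions $$\frac{\beta_j^{j\in J'},\ \mathrm{Pred},\ \mathrm{Post}}{s\xrightarrow{\alpha}s'}$$ (actions $\beta_j$ of some of the holes, a predicate, an assignment of the variables of $P$) are generated by the pLTS transitions and, for each synchronisation vector, by composing open transitions of the involved sub-pNets with actions of the involved holes, the predicate being the conjunction of the predicates of the sub-pNets, of the equalities between the actual actions and those of the vector, and of the guard; open transitions are closed under substitution of variables other than those of $P$ and under strengthening of the predicate. Weak open transitions are generated by: the identity $\tau$-transition on each state; each open transition, with the $\tau$ actions of the holes erased and every other hole action regarded as a sequence of length one; and the sequential composition of a weak $\tau$-transition, a weak $\alpha$-transition and a weak $\tau$-transition (concatenating the sequences $\gamma_j$ of hole actions, and applying the accumulated assignments to hole actions, predicates and $\alpha$). \textbf{Weak FH-bisimilarity.} Consider two open automata with the same holes with the same sorts, their variables being taken apart. A weak FH-bisimulation assigns to each pair of states $(s,t)$ a predicate $\mathrm{Pred}_{s,t}$ over the variables of both automata such that for every open transition of the first automaton from $s$ as above there is a family, indexed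 by $x\in X$, of weak open transitions of the second automaton from $t$, with sequences of hole actions $\gamma_{jx}^{j\in J_x}$, predicate $\mathrm{Pred}_x$, assignment $\mathrm{Post}_x$, action $\alpha_x$ and target $t_x$, with $J_x=\{j\in J'\mid\beta_j\neq\tau\}$ for all $x$ and $$\mathrm{Pred}_{s,t}\wedge\mathrm{Pred}\Rightarrow\bigvee_{x\in X}\Bigl(\forall j\in J_x.\ [\beta_j]=\gamma_{jx}\ \wedge\ \mathrm{Pred}_x\ \wedge\ \alpha=\alpha_x\ \wedge\ \mathrm{Pred}_{s',t_x}\{\mathrm{Post}\uplus\mathrm{Post}_x\}\Bigr),$$ and symmetrically. Two pNets are weak FH-bisimilar if there is a weak FH-bisimulation between their open automata whose predicate on the pair of initial states is true (for all initial values of the variables, a variable that occurs in both pNets having the same initial value in both). A node \emph{cannot observe silent actions} if for each sub-pNet or hole $l\in I\uplus J$ it has the vector $(l\mapsto\tau)\to\tau\,[\mathrm{True}]$, and if every vector in which a hole $j\in J$ has the component $\tau$ has no other component and has global action $\tau$. \textbf{Theorem (Context equivalence for weak bisimulation).} Let $P=\langle\langle P_i^{i\in I},\mathrm{Sort}_j^{j\in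 J},SV_k^{k\in K}\rangle\rangle$ and $P'=\langle\langle P_i'^{\,i\in I'},\mathrm{Sort}_j^{j\in J},SV_k'^{\,k\in K'}\rangle\rangle$ be weak FH-bisimilar pNets, both unable to observe silent actions. Let $j_0\in J$ and let $Q$ be a pNet with $\mathrm{Sort}(Q)=\mathrm{Sort}_{j_0}$, such that $Q$ shares no variable with $P$ or $P'$ and no hole index with $P$ other than possibly $j_0$ (so that $P[Q]_{j_0}$ and $P'[Q]_{j_0}$ are pNets). Then $P[Q]_{j_0}$ and $P'[Q]_{j_0}$ are weak FH-bisimilar. -/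

import Mathlib

universe u

/-! ### Term algebra -/

/-- The data the formalism is parametric in: operators of the signature with their interpretation
on data values, the truth value `tt`, action labels with the label of the silent action, and the
three kinds of names.  `StateVar` are the names of the variables of pLTSs; `LocalVar` are all the
other variables (input variables of actions, variables of synchronisation vectors, free variables
of open transitions), so that these never clash with state variables. -/
structure TermAlgebra : Type (u + 1) where
  Op : Type u
  arity : Op → ℕ
  Val : Type u
  interp : (f : Op) → (Fin (arity f) → Val) → Val
  tt : Val
  Label : Type u
  tau : Label
  StateVar : Type u
  LocalVar : Type u
  Hole : Type u

/-- An action signature: a label with an arity. -/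
abbrev TermAlgebra.Signature (𝔸 : TermAlgebra.{u}) : Type u := 𝔸.Label × ℕ

/-- Expressions `Value | x | op(e₁,…,eₙ)` over the variables `X`.  A boolean expression is an
expression used as a guard; it holds when its value is `tt`. -/
inductive Expr (𝔸 : TermAlgebra.{u}) (X : Type u) : Type u
  | val (d : 𝔸.Val) : Expr 𝔸 X
  | var (x : X) : Expr 𝔸 X
  | app (f : 𝔸.Op) (args : Fin (𝔸.arity f) → Expr 𝔸 X) : Expr 𝔸 X

namespace Expr

variable {𝔸 : TermAlgebra.{u}} {X Y : Type u}

/-- Parallel substitution. -/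
def subst (σ : X → Expr 𝔸 Y) : Expr 𝔸 X → Expr 𝔸 Y
  | val d => val d
  | var x => σ x
  | app f args => app f (fun i => subst σ (args i))

def rename (g : X → Y) (e : Expr 𝔸 X) : Expr 𝔸 Y := e.subst (fun x => var (g x))

def eval (ρ : X → 𝔸.Val) : Expr 𝔸 X → 𝔸.Val
  | val d => d
  | var x => ρ x
  | app f args => 𝔸.interp f (fun i => eval ρ (args i))

def vars : Expr 𝔸 X → Set X
  | val _ => ∅
  | var x => {x}
  | app _ args => ⋃ i, vars (args i)

/-- The boolean expression `e` is true under the valuation `ρ`. -/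
def Holds (ρ : X → 𝔸.Val) (e : Expr 𝔸 X) : Prop := e.eval ρ = 𝔸.tt

end Expr

/-- Action terms `a(e₁,…,eₙ)` that do not distinguish input variables. -/
@[ext] structure Act (𝔸 : TermAlgebra.{u}) (X : Type u) : Type u where
  label : 𝔸.Label
  args : List (Expr 𝔸 X)

namespace Act

variable {𝔸 : TermAlgebra.{u}} {X Y : Type u}

def sig (a : Act 𝔸 X) : 𝔸.Signature := (a.label, a.args.length)

def subst (σ : X → Expr 𝔸 Y) (a : Act 𝔸 X) : Act 𝔸 Y := ⟨a.label, a.args.map (Expr.subst σ)⟩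

def rename (g : X → Y) (a : Act 𝔸 X) : Act 𝔸 Y := a.subst (fun x => Expr.var (g x))

/-- The concrete action denoted under a valuation.  Equality `α = α'` of actions inside a predicate
means equality of the denoted concrete actions. -/
def eval (ρ : X → 𝔸.Val) (a : Act 𝔸 X) : 𝔸.Label × List 𝔸.Val :=
  (a.label, a.args.map (Expr.eval ρ))

def vars (a : Act 𝔸 X) : Set X := {x | ∃ e ∈ a.args, x ∈ e.vars}

/-- The silent action `τ`. -/
def silent : Act 𝔸 X := ⟨𝔸.tau, []⟩

end Act

/-! ### Parameterised networks -/

/-- Parameters of the actions of a pLTS with variables `V`: an input variable `?x`, or an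
expression over `V`. -/
inductive Param (𝔸 : TermAlgebra.{u}) (V : Type u) : Type u
  | input (x : 𝔸.LocalVar) : Param 𝔸 V
  | expr (e : Expr 𝔸 V) : Param 𝔸 V

namespace Param

variable {𝔸 : TermAlgebra.{u}} {V : Type u}

def inputVar? : Param 𝔸 V → Option 𝔸.LocalVar
  | input x => some x
  | expr _ => none

/-- Removal of the input marker. -/
def unmark : Param 𝔸 V → Expr 𝔸 (V ⊕ 𝔸.LocalVar)
  | input x => Expr.var (Sum.inr x)
  | expr e => e.rename Sum.inl

end Param

/-- Labels `⟨α, e_b, (x_j := e_j)⟩` of a pLTS with variables `V`, where `α` is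
`label(params)`.  The variables of the expression parameters of `α` are in `V`; those of the guard
and of the assigned expressions are in `V` or are input variables of `α`.  An input variable occurs
only once in `α`. -/
structure LTSLabel (𝔸 : TermAlgebra.{u}) (V : Type u) : Type u where
  label : 𝔸.Label
  params : List (Param 𝔸 V)
  guard : Expr 𝔸 (V ⊕ 𝔸.LocalVar)
  assign : V → Option (Expr 𝔸 (V ⊕ 𝔸.LocalVar))
  inputs_nodup : (params.filterMap Param.inputVar?).Nodup
  guard_vars : ∀ x, Sum.inr x ∈ guard.vars → x ∈ params.filterMap Param.inputVar?
  assign_vars : ∀ v e, assign v = some e →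
    ∀ x, Sum.inr x ∈ e.vars → x ∈ params.filterMap Param.inputVar?

/-- The action of a label, without input markers. -/
def LTSLabel.act {𝔸 : TermAlgebra.{u}} {V : Type u} (l : LTSLabel 𝔸 V) :
    Act 𝔸 (V ⊕ 𝔸.LocalVar) :=
  ⟨l.label, l.params.map Param.unmark⟩

/-- Parameterised labelled transition systems `⟨S, s₀, V, →⟩`. -/
structure PLTS (𝔸 : TermAlgebra.{u}) : Type (u + 1) where
  State : Type u
  init : State
  vars : Set 𝔸.StateVar
  step : State → LTSLabel 𝔸 vars → State → Prop

/-- Synchronisation vectors `(α_l)^{l ∈ I_k ⊎ J_k} → α' [e]` for sub-pNets indexed by `I`: `sub`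
and `hole` are the partial families of the actions of the sub-pNets and of the holes. -/
structure SyncVec (𝔸 : TermAlgebra.{u}) (I : Type u) : Type u where
  sub : I → Option (Act 𝔸 𝔸.LocalVar)
  hole : 𝔸.Hole → Option (Act 𝔸 𝔸.LocalVar)
  act : Act 𝔸 𝔸.LocalVar
  guard : Expr 𝔸 𝔸.LocalVar

/-- The variables of the component actions of a vector. -/
def SyncVec.compVars {𝔸 : TermAlgebra.{u}} {I : Type u} (v : SyncVec 𝔸 I) : Set 𝔸.LocalVar :=
  {x | (∃ i a, v.sub i = some a ∧ x ∈ a.vars) ∨ (∃ j a, v.hole j = some a ∧ x ∈ a.vars)}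

/-- The tree structure of pNets: a pLTS, or a node `⟨P_i^{i ∈ I}, Sort_j^{j ∈ J}, SV_k^{k ∈ K}⟩`.
The side conditions of pNets are in `PNet.WellFormed`. -/
inductive PNet (𝔸 : TermAlgebra.{u}) : Type (u + 1)
  | lts (L : PLTS 𝔸) : PNet 𝔸
  | node (I : Type u) (sub : I → PNet 𝔸) (J : Set 𝔸.Hole) (sort : J → Set 𝔸.Signature)
      (K : Type u) (SV : K → SyncVec 𝔸 I) : PNet 𝔸

namespace PNet

variable {𝔸 : TermAlgebra.{u}}

/-- The sort of a pNet: the signatures of the actions it can expose. -/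
def sortOf : PNet 𝔸 → Set 𝔸.Signature
  | lts L => {σ | ∃ s l s', L.step s l s' ∧ l.act.sig = σ}
  | node _ _ _ _ _ SV => {σ | ∃ k, (SV k).act.sig = σ}

/-- The indexes of the holes of a pNet and of its sub-pNets. -/
def holes : PNet 𝔸 → Set 𝔸.Hole
  | lts _ => ∅
  | node _ sub J _ _ _ => J ∪ ⋃ i, (sub i).holes

/-- The sort of the hole `h` (empty if `h` is not a hole of the pNet). -/
def holeSort : PNet 𝔸 → 𝔸.Hole → Set 𝔸.Signature
  | lts _, _ => ∅
  | node _ sub J sort _ _, h => {σ | (∃ hj : h ∈ J, σ ∈ sort ⟨h, hj⟩) ∨ ∃ i, σ ∈ (sub i).holeSort h}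

/-- The variables of a pNet: the disjoint union of the variables of its pLTSs. -/
def Vars : PNet 𝔸 → Type u
  | lts L => L.vars
  | node I sub _ _ _ _ => Σ i : I, (sub i).Vars

/-- The name of a variable of a pNet. -/
def varName : (P : PNet 𝔸) → P.Vars → 𝔸.StateVar
  | lts _, v => v.1
  | node _ sub _ _ _ _, v => (sub v.1).varName v.2

/-- The set of the names of the variables of a pNet. -/
def vars (P : PNet 𝔸) : Set 𝔸.StateVar := Set.range P.varName

/-- The states of a pNet: tuples of states of the leaves, grouped along the tree structure. -/
def State : PNet 𝔸 → Type u
  | lts L => L.State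
  | node I sub _ _ _ _ => (i : I) → (sub i).State

def initState : (P : PNet 𝔸) → P.State
  | lts L => L.init
  | node _ sub _ _ _ _ => fun i => (sub i).initState

/-- The side conditions in the definition of pNets, at every node: sub-pNets have disjoint
variables, hole indexes are pairwise disjoint, the components of the synchronisation vectors belong
to the sort of the sub-pNet or hole they refer to, and the variables of the global action and of the
guard of a vector occur in its component actions. -/
def WellFormed : PNet 𝔸 → Prop
  | lts _ => True
  | node I sub J sort _ SV =>
      (∀ i, (sub i).WellFormed) ∧
      (Nonempty I ∨ J.Nonempty) ∧
      (∀ i i', i ≠ i' → Disjoint (sub i).vars (sub i').vars) ∧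
      (∀ i, Disjoint (sub i).holes J) ∧
      (∀ i i', i ≠ i' → Disjoint (sub i).holes (sub i').holes) ∧
      ∀ k,
        (∀ i a, (SV k).sub i = some a → a.sig ∈ (sub i).sortOf) ∧
        (∀ j a, (SV k).hole j = some a → ∃ hj : j ∈ J, a.sig ∈ sort ⟨j, hj⟩) ∧
        (SV k).act.vars ⊆ (SV k).compVars ∧
        (SV k).guard.vars ⊆ (SV k).compVars

open Classical in
/-- Composition `P[Q]_{j₀}` for a hole `j₀ ∈ J` of the node `P`.  The index set `I ⊎ {j₀}` is
`Option I`, with `none` for `j₀`; the synchronisation vectors are unchanged up to this reindexing.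
(For other arguments this is a default value.) -/
noncomputable def fill : PNet 𝔸 → 𝔸.Hole → PNet 𝔸 → PNet 𝔸
  | lts L, _, _ => lts L
  | node I sub J sort K SV, j₀, Q =>
      node (Option I)
        (fun o => o.elim Q sub)
        (J \ {j₀})
        (fun j => sort ⟨j.1, j.2.1⟩)
        K
        (fun k =>
          { sub := fun o => o.elim ((SV k).hole j₀) (SV k).sub
            hole := fun j => if j = j₀ then none else (SV k).hole j
            act := (SV k).act
            guard := (SV k).guard })

/-- A pNet cannot observe silent actions: each silent action of a sub-pNet or of a hole can go
through on its own, and a vector that has a silent action of a hole as a component has no other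
component and exposes `τ`. -/
def CannotObserveSilent : PNet 𝔸 → Prop
  | lts _ => True
  | node I _ J _ _ SV =>
      (∀ i : I, ∃ k,
        (∀ i', (SV k).sub i' = some Act.silent ∧ i' = i ∨ (SV k).sub i' = none ∧ i' ≠ i) ∧
        (∀ j, (SV k).hole j = none) ∧
        (SV k).act = Act.silent ∧ ∀ ρ, (SV k).guard.Holds ρ) ∧
      (∀ j ∈ J, ∃ k,
        (∀ i, (SV k).sub i = none) ∧
        (∀ j', (SV k).hole j' = some Act.silent ∧ j' = j ∨ (SV k).hole j' = none ∧ j' ≠ j) ∧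
        (SV k).act = Act.silent ∧ ∀ ρ, (SV k).guard.Holds ρ) ∧
      ∀ k, ∀ j ∈ J, (SV k).hole j = some Act.silent →
        (SV k).act = Act.silent ∧
        (∀ i, (SV k).sub i = none) ∧
        (∀ j', j' ≠ j → (SV k).hole j' = none)

end PNet

/-! ### Open transitions and open automata -/

/-- Predicates over the variables `X`, up to logical equivalence: sets of valuations. -/
abbrev Pred (𝔸 : TermAlgebra.{u}) (X : Type u) : Type u := (X → 𝔸.Val) → Prop

/-- Application of a substitution to a predicate. -/
def Pred.subst {𝔸 : TermAlgebra.{u}} {X Y : Type u} (σ : X → Expr 𝔸 Y) (p : Pred 𝔸 X) : Pred 𝔸 Y :=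
  fun ρ => p (fun x => (σ x).eval ρ)

/-- The substitution acting as `post` on the variables `V` of the automaton, and as the identity on
local variables. -/
def postSubst {𝔸 : TermAlgebra.{u}} {V : Type u} (post : V → Expr 𝔸 (V ⊕ 𝔸.LocalVar)) :
    V ⊕ 𝔸.LocalVar → Expr 𝔸 (V ⊕ 𝔸.LocalVar) :=
  Sum.elim post (fun x => Expr.var (Sum.inr x))

/-- The substitution acting as `θ` on local variables, and as the identity on the variables `V` of
the automaton. -/
def localSubst {𝔸 : TermAlgebra.{u}} {V : Type u}
    (θ : 𝔸.LocalVar → Expr 𝔸 (V ⊕ 𝔸.LocalVar)) :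
    V ⊕ 𝔸.LocalVar → Expr 𝔸 (V ⊕ 𝔸.LocalVar) :=
  Sum.elim (fun v => Expr.var (Sum.inl v)) θ

/-- The identity assignment `Id(V)`. -/
def idPost {𝔸 : TermAlgebra.{u}} {V : Type u} (v : V) : Expr 𝔸 (V ⊕ 𝔸.LocalVar) :=
  Expr.var (Sum.inl v)

/-- The composition `post₂ ⊗ post₁` of assignments: first `post₁`, then `post₂`. -/
def postComp {𝔸 : TermAlgebra.{u}} {V : Type u} (post₂ post₁ : V → Expr 𝔸 (V ⊕ 𝔸.LocalVar)) :
    V → Expr 𝔸 (V ⊕ 𝔸.LocalVar) :=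
  fun v => (post₂ v).subst (postSubst post₁)

/-- Open transitions for variables `V` and states `S`.  `β` is the partial family of the actions of
the holes; `post` is the assignment, extended by the identity to a total one. -/
structure OpenTransition (𝔸 : TermAlgebra.{u}) (V S : Type u) : Type u where
  src : S
  tgt : S
  β : 𝔸.Hole → Option (Act 𝔸 (V ⊕ 𝔸.LocalVar))
  act : Act 𝔸 (V ⊕ 𝔸.LocalVar)
  pred : Pred 𝔸 (V ⊕ 𝔸.LocalVar)
  post : V → Expr 𝔸 (V ⊕ 𝔸.LocalVar)

namespace OpenTransition

variable {𝔸 : TermAlgebra.{u}} {V S : Type u}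

/-- Refinement of an open transition: a substitution of the variables that are not in `V`, and a
strengthening of the predicate. -/
def refine (t : OpenTransition 𝔸 V S) (θ : 𝔸.LocalVar → Expr 𝔸 (V ⊕ 𝔸.LocalVar))
    (p : Pred 𝔸 (V ⊕ 𝔸.LocalVar)) : OpenTransition 𝔸 V S where
  src := t.src
  tgt := t.tgt
  β h := (t.β h).map (Act.subst (localSubst θ))
  act := t.act.subst (localSubst θ)
  pred ρ := t.pred.subst (localSubst θ) ρ ∧ p ρ
  post v := (t.post v).subst (localSubst θ)

/-- No transition: the state does not change and no hole acts (`act` is irrelevant). -/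
def IsIdle (t : OpenTransition 𝔸 V S) : Prop :=
  t.tgt = t.src ∧ (∀ h, t.β h = none) ∧ (∀ ρ, t.pred ρ) ∧ t.post = idPost

end OpenTransition

/-- The closure of a set of open transitions under refinement. -/
inductive Refinements {𝔸 : TermAlgebra.{u}} {V S : Type u} (T : Set (OpenTransition 𝔸 V S)) :
    OpenTransition 𝔸 V S → Prop
  | base (t : OpenTransition 𝔸 V S) (ht : t ∈ T) : Refinements T t
  | refine (t : OpenTransition 𝔸 V S) (θ : 𝔸.LocalVar → Expr 𝔸 (V ⊕ 𝔸.LocalVar))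
      (p : Pred 𝔸 (V ⊕ 𝔸.LocalVar)) (ht : Refinements T t) : Refinements T (t.refine θ p)

/-- Open automata `⟨J, S, s₀, V, T⟩` (with the sorts of the holes), closed under refinement. -/
structure OpenAutomaton (𝔸 : TermAlgebra.{u}) : Type (u + 1) where
  holes : Set 𝔸.Hole
  sort : 𝔸.Hole → Set 𝔸.Signature
  State : Type u
  init : State
  Vars : Type u
  varName : Vars → 𝔸.StateVar
  trans : Set (OpenTransition 𝔸 Vars State)
  trans_holes : ∀ t ∈ trans, ∀ h b, t.β h = some b → h ∈ holes ∧ b.sig ∈ sort h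
  trans_refine : ∀ t ∈ trans, ∀ θ p, t.refine θ p ∈ trans

/-! ### Semantics of pNets -/

/-- The rule for a pLTS. -/
def PLTS.Rule {𝔸 : TermAlgebra.{u}} (L : PLTS 𝔸) (t : OpenTransition 𝔸 L.vars L.State) : Prop :=
  ∃ l : LTSLabel 𝔸 L.vars, L.step t.src l t.tgt ∧
    (∀ h, t.β h = none) ∧
    t.act = l.act ∧
    t.pred = (fun ρ => l.guard.Holds ρ) ∧
    ∀ v, t.post v = (l.assign v).getD (idPost v)

/-- The rule for a pNet node and its synchronisation vector `sv`, where `T i` is the set of open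
transitions of the sub-pNet `i`.  The sub-pNets involved in `sv` make a transition `t i`, the others
are idle.  The variables of the vector are instantiated by `ν`: as open transitions are closed under
substitution of their local variables, this amounts to choosing fresh variables for the vector, for
the actions of the holes and for the resulting action, and then substituting them. -/
def NodeRule {𝔸 : TermAlgebra.{u}} {I : Type u} {V S : I → Type u} (subHoles : I → Set 𝔸.Hole)
    (T : (i : I) → Set (OpenTransition 𝔸 (V i) (S i))) (J : Set 𝔸.Hole)
    (sort : J → Set 𝔸.Signature) (sv : SyncVec 𝔸 I)
    (o : OpenTransition 𝔸 (Σ i, V i) ((i : I) → S i)) : Prop :=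
  ∃ (t : (i : I) → OpenTransition 𝔸 (V i) (S i))
    (ν : 𝔸.LocalVar → Expr 𝔸 ((Σ i, V i) ⊕ 𝔸.LocalVar)),
    (∀ i, (sv.sub i).isSome → t i ∈ T i) ∧
    (∀ i, sv.sub i = none → (t i).IsIdle) ∧
    (∀ i, o.src i = (t i).src) ∧
    (∀ i, o.tgt i = (t i).tgt) ∧
    -- the holes that act
    (∀ j : J, (o.β j).isSome ↔ (sv.hole j).isSome) ∧
    (∀ j : J, ∀ b, o.β j = some b → b.sig ∈ sort j) ∧
    (∀ i, ∀ h ∈ subHoles i, o.β h = ((t i).β h).map (Act.rename (Sum.map (Sigma.mk i) id))) ∧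
    (∀ h, h ∉ J → (∀ i, h ∉ subHoles i) → o.β h = none) ∧
    -- the assignments
    (∀ i v, o.post ⟨i, v⟩ = ((t i).post v).rename (Sum.map (Sigma.mk i) id)) ∧
    -- the predicate
    o.pred = fun ρ =>
      (∀ i, (t i).pred (fun x => ρ (Sum.map (Sigma.mk i) id x))) ∧
      (∀ i a, sv.sub i = some a →
        (t i).act.eval (fun x => ρ (Sum.map (Sigma.mk i) id x)) = (a.subst ν).eval ρ) ∧
      (∀ j ∈ J, ∀ a b, sv.hole j = some a → o.β j = some b → b.eval ρ = (a.subst ν).eval ρ) ∧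
      o.act.eval ρ = (sv.act.subst ν).eval ρ ∧
      (sv.guard.subst ν).Holds ρ

namespace PNet

variable {𝔸 : TermAlgebra.{u}}

/-- The open transitions of a pNet. -/
def trans : (P : PNet 𝔸) → Set (OpenTransition 𝔸 P.Vars P.State)
  | lts L => {t | Refinements {o : OpenTransition 𝔸 L.vars L.State | L.Rule o} t}
  | node I sub J sort _ SV =>
      {t | Refinements {o : OpenTransition 𝔸 (Σ i : I, (sub i).Vars) ((i : I) → (sub i).State) |
        ∃ k, NodeRule (fun i => (sub i).holes) (fun i => (sub i).trans) J sort (SV k) o} t}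

theorem trans_refine (P : PNet 𝔸) (t : OpenTransition 𝔸 P.Vars P.State) (ht : t ∈ P.trans)
    (θ : 𝔸.LocalVar → Expr 𝔸 (P.Vars ⊕ 𝔸.LocalVar)) (p : Pred 𝔸 (P.Vars ⊕ 𝔸.LocalVar)) :
    t.refine θ p ∈ P.trans := by
  cases P with
  | lts L => exact Refinements.refine t θ p ht
  | node I sub J sort K SV => exact Refinements.refine t θ p ht

theorem refinements_holes {V S : Type u} {T : Set (OpenTransition 𝔸 V S)} {H : Set 𝔸.Hole}
    {srt : 𝔸.Hole → Set 𝔸.Signature}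
    (hT : ∀ t ∈ T, ∀ h b, t.β h = some b → h ∈ H ∧ b.sig ∈ srt h)
    (t : OpenTransition 𝔸 V S) (ht : Refinements T t) :
    ∀ h b, t.β h = some b → h ∈ H ∧ b.sig ∈ srt h := by
  induction ht with
  | base t ht => exact hT t ht
  | refine t θ p _ ih =>
    intro h b hb
    obtain ⟨a, ha, rfl⟩ := Option.map_eq_some_iff.1 hb
    have := ih h a ha
    simpa [Act.sig, Act.subst] using this

theorem trans_holes (P : PNet 𝔸) : ∀ t ∈ P.trans, ∀ h b, t.β h = some b →
    h ∈ P.holes ∧ b.sig ∈ P.holeSort h := by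
  induction P with
  | lts L =>
    refine fun t ht => refinements_holes (T := {o | L.Rule o}) ?_ t ht
    rintro t ⟨l, _, hβ, _⟩ h b hb
    rw [hβ h] at hb
    cases hb
  | node I sub J sort K SV ih =>
    refine fun t ht => refinements_holes (T := {o | ∃ k, NodeRule _ _ J sort (SV k) o}) ?_ t ht
    rintro o ⟨k, t, ν, hT, hidle, -, -, -, hsort, hsub, hout, -⟩ h b hb
    by_cases hJ : h ∈ J
    · exact ⟨Or.inl hJ, Or.inl ⟨hJ, hsort ⟨h, hJ⟩ b hb⟩⟩
    · by_cases hS : ∃ i, h ∈ (sub i).holes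
      · obtain ⟨i, hi⟩ := hS
        rw [hsub i h hi] at hb
        obtain ⟨a, ha, rfl⟩ := Option.map_eq_some_iff.1 hb
        have hmem : t i ∈ (sub i).trans := by
          apply hT
          by_contra hn
          have := (hidle i (by simpa using hn)).2.1 h
          rw [this] at ha
          cases ha
        have := ih i (t i) hmem h a ha
        refine ⟨Or.inr (Set.mem_iUnion.2 ⟨i, hi⟩), Or.inr ⟨i, ?_⟩⟩
        simpa [Act.sig, Act.subst, Act.rename] using this.2
      · rw [hout h hJ (by simpa using hS)] at hb
        cases hb

/-- The open automaton that is the semantics of a pNet. -/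
def automaton (P : PNet 𝔸) : OpenAutomaton 𝔸 where
  holes := P.holes
  sort := P.holeSort
  State := P.State
  init := P.initState
  Vars := P.Vars
  varName := P.varName
  trans := P.trans
  trans_holes := P.trans_holes
  trans_refine := P.trans_refine

end PNet

/-! ### Weak open transitions and weak bisimulation -/

/-- Weak open transitions: as open transitions, but each hole performs a sequence of actions (the
empty sequence for the holes outside the domain of the family). -/
structure WeakOpenTransition (𝔸 : TermAlgebra.{u}) (V S : Type u) : Type u where
  src : S
  tgt : S
  γ : 𝔸.Hole → List (Act 𝔸 (V ⊕ 𝔸.LocalVar))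
  act : Act 𝔸 (V ⊕ 𝔸.LocalVar)
  pred : Pred 𝔸 (V ⊕ 𝔸.LocalVar)
  post : V → Expr 𝔸 (V ⊕ 𝔸.LocalVar)

open Classical in
/-- The sequence of visible actions of a hole: of length at most one, empty for `τ`. -/
noncomputable def visible {𝔸 : TermAlgebra.{u}} {X : Type u} : Option (Act 𝔸 X) → List (Act 𝔸 X)
  | none => []
  | some b => if b = Act.silent then [] else [b]

namespace WeakOpenTransition

variable {𝔸 : TermAlgebra.{u}} {V S : Type u}

/-- The silent weak transition at state `s`. -/
def stay (s : S) : WeakOpenTransition 𝔸 V S where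
  src := s
  tgt := s
  γ _ := []
  act := Act.silent
  pred _ := True
  post := idPost

/-- An open transition as a weak one. -/
noncomputable def ofOpen (t : OpenTransition 𝔸 V S) : WeakOpenTransition 𝔸 V S where
  src := t.src
  tgt := t.tgt
  γ h := visible (t.β h)
  act := t.act
  pred := t.pred
  post := t.post

/-- The sequence of the weak transitions `w₁`, `w₂`, `w₃`, labelled as `w₂`. -/
def seq (w₁ w₂ w₃ : WeakOpenTransition 𝔸 V S) : WeakOpenTransition 𝔸 V S where
  src := w₁.src
  tgt := w₃.tgt
  γ h := w₁.γ h ++ (w₂.γ h).map (Act.subst (postSubst w₁.post)) ++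
    (w₃.γ h).map (Act.subst (postSubst (postComp w₂.post w₁.post)))
  act := w₂.act.subst (postSubst w₁.post)
  pred ρ := w₁.pred ρ ∧ w₂.pred.subst (postSubst w₁.post) ρ ∧
    w₃.pred.subst (postSubst (postComp w₂.post w₁.post)) ρ
  post := postComp w₃.post (postComp w₂.post w₁.post)

end WeakOpenTransition

/-- The transitions of the weak open automaton derived from `A`. -/
inductive OpenAutomaton.WeakTrans {𝔸 : TermAlgebra.{u}} (A : OpenAutomaton 𝔸) :
    WeakOpenTransition 𝔸 A.Vars A.State → Prop
  | stay (s : A.State) : A.WeakTrans (WeakOpenTransition.stay s)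
  | ofOpen (t : OpenTransition 𝔸 A.Vars A.State) (ht : t ∈ A.trans) :
      A.WeakTrans (WeakOpenTransition.ofOpen t)
  | seq (w₁ w₂ w₃ : WeakOpenTransition 𝔸 A.Vars A.State)
      (h₁ : A.WeakTrans w₁) (h₂ : A.WeakTrans w₂) (h₃ : A.WeakTrans w₃)
      (h₁₂ : w₁.tgt = w₂.src) (h₂₃ : w₂.tgt = w₃.src)
      (hτ₁ : w₁.act = Act.silent) (hτ₃ : w₃.act = Act.silent) :
      A.WeakTrans (WeakOpenTransition.seq w₁ w₂ w₃)

/-- A relation `{(s, t | Pred_{s,t})}` between the states of two automata: to each pair of states it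
associates a predicate over the variables of the first automaton and those of the second one, where
these two sets of variables are taken apart. -/
abbrev StateRel {𝔸 : TermAlgebra.{u}} (A B : OpenAutomaton 𝔸) : Type u :=
  A.State → B.State → (A.Vars → 𝔸.Val) → (B.Vars → 𝔸.Val) → Prop

/-- Every open transition of `A` is covered by a family `X` of weak open transitions of `B`. -/
def WeakSimulation {𝔸 : TermAlgebra.{u}} (A B : OpenAutomaton 𝔸) (R : StateRel A B) : Prop :=
  ∀ (s : A.State) (t : B.State), ∀ o ∈ A.trans, o.src = s →
    ∃ X : Set (WeakOpenTransition 𝔸 B.Vars B.State),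
      (∀ w ∈ X, B.WeakTrans w ∧ w.src = t ∧
        {j | ∃ b, o.β j = some b ∧ b ≠ Act.silent} = {j | w.γ j ≠ []}) ∧
      ∀ (ρ₁ : A.Vars → 𝔸.Val) (ρ₂ : B.Vars → 𝔸.Val) (φ : 𝔸.LocalVar → 𝔸.Val),
        R s t ρ₁ ρ₂ → o.pred (Sum.elim ρ₁ φ) →
        ∃ w ∈ X,
          (∀ j, (visible (o.β j)).map (Act.eval (Sum.elim ρ₁ φ)) =
            (w.γ j).map (Act.eval (Sum.elim ρ₂ φ))) ∧
          w.pred (Sum.elim ρ₂ φ) ∧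
          o.act.eval (Sum.elim ρ₁ φ) = w.act.eval (Sum.elim ρ₂ φ) ∧
          R o.tgt w.tgt (fun v => (o.post v).eval (Sum.elim ρ₁ φ))
            (fun v => (w.post v).eval (Sum.elim ρ₂ φ))

/-- Weak FH-bisimulations between open automata. -/
def IsWeakFHBisimulation {𝔸 : TermAlgebra.{u}} (A B : OpenAutomaton 𝔸) (R : StateRel A B) : Prop :=
  WeakSimulation A B R ∧ WeakSimulation B A (fun t s ρ₂ ρ₁ => R s t ρ₁ ρ₂)

/-- Weak FH-bisimilarity: the automata have the same holes with the same sorts, and are related by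
a weak FH-bisimulation whose predicate on initial states is true.  A variable that belongs to both
automata has the same initial value in both; when the sets of variables are disjoint, the condition
on initial states is that the predicate holds for all values of the variables. -/
def OpenAutomaton.WeakFHBisimilar {𝔸 : TermAlgebra.{u}} (A B : OpenAutomaton 𝔸) : Prop :=
  A.holes = B.holes ∧ (∀ h ∈ A.holes, A.sort h = B.sort h) ∧
    ∃ R : StateRel A B, IsWeakFHBisimulation A B R ∧
      ∀ ρ : 𝔸.StateVar → 𝔸.Val,
        R A.init B.init (fun v => ρ (A.varName v)) (fun v => ρ (B.varName v))

/-- Two pNets are weak FH-bisimilar if the open automata of their semantics are. -/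
def PNet.WeakFHBisimilar {𝔸 : TermAlgebra.{u}} (P Q : PNet 𝔸) : Prop :=
  P.automaton.WeakFHBisimilar Q.automaton

/-! Symbolic transitions only matter through their concrete instances. Open transitions are closed
under substitution of their local variables, so every concrete step is an instance of an open
transition with values substituted for its local variables, which has this instance whatever those
variables are worth (`GroundStep.exists_uniform`). The same holds for weak transitions
(`GroundWeak.exists_weakTrans`), and a symbolic weak simulation is exactly a weak simulation between
concrete steps (`weakSimulation_iff`). The family `X` disappears: for each valuation it suffices to
find one answer.

Concretely, a step of a node is a vector, values for its variables, and matching moves of the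
components (`groundStep_node_iff`). A step of `P[Q]` is therefore a step of `P` together with a move
of `Q` whose action is the one that `P` expects from `j₀`, or no move if `j₀` does not act
(`GroundNode.of_fill`, `GroundNode.fill`).

The bisimulation `fillRel` asks for equal `Q` components and for `R` on the rest. Let `P[Q]` make a
step. If `Q` is idle, `P'` answers with a weak step that has no visible action at `j₀`, and this
lifts with `Q` idle (`GroundWeak.fill_idle`). If `Q` makes a visible action `c`, the answer of `P'`
has `c` exactly once at `j₀`; `Q` moves at that point and idles elsewhere (`GroundWeak.fill_step`).
If `Q` makes `τ`, then `P` does nothing else, and `P'[Q]` answers through its own vector `j₀ ↦ τ`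
(`GroundStep.fill_silent`). Silent actions of `j₀` hidden inside the answers of `P'` are harmless:
such a step changes neither state nor variables and can be deleted (`GroundNode.eq_of_silent`). This
is where the inability to observe silent actions is used. -/

/-! ### Evaluation and substitution -/

section Evaluation

variable {𝔸 : TermAlgebra.{u}} {X Y : Type u}

/-- The concrete actions: closed action terms up to evaluation. -/
abbrev TermAlgebra.GroundAct (𝔸 : TermAlgebra.{u}) : Type u := 𝔸.Label × List 𝔸.Val

/-- The concrete silent action. -/
abbrev TermAlgebra.groundTau (𝔸 : TermAlgebra.{u}) : 𝔸.GroundAct := (𝔸.tau, [])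

theorem Expr.eval_subst (σ : X → Expr 𝔸 Y) (ρ : Y → 𝔸.Val) (e : Expr 𝔸 X) :
    (e.subst σ).eval ρ = e.eval (fun x => (σ x).eval ρ) := by
  induction e with
  | val d => rfl
  | var x => rfl
  | app f args ih => simp only [Expr.subst, Expr.eval, ih]

theorem Expr.eval_rename (g : X → Y) (ρ : Y → 𝔸.Val) (e : Expr 𝔸 X) :
    (e.rename g).eval ρ = e.eval (fun x => ρ (g x)) :=
  e.eval_subst _ ρ

theorem Act.eval_subst (σ : X → Expr 𝔸 Y) (ρ : Y → 𝔸.Val) (a : Act 𝔸 X) :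
    (a.subst σ).eval ρ = a.eval (fun x => (σ x).eval ρ) := by
  simp [Act.eval, Act.subst, Function.comp_def, Expr.eval_subst]

theorem Act.eval_rename (g : X → Y) (ρ : Y → 𝔸.Val) (a : Act 𝔸 X) :
    (a.rename g).eval ρ = a.eval (fun x => ρ (g x)) :=
  a.eval_subst _ ρ

theorem Act.eval_silent (ρ : X → 𝔸.Val) : (Act.silent : Act 𝔸 X).eval ρ = 𝔸.groundTau := rfl

/-- Evaluation keeps the label and the number of arguments, so being silent is a syntactic property
that no valuation changes. Hence erasing `τ` commutes with evaluation. -/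
theorem Act.eval_eq_groundTau {ρ : X → 𝔸.Val} {a : Act 𝔸 X} :
    a.eval ρ = 𝔸.groundTau ↔ a = Act.silent := by
  obtain ⟨l, as⟩ := a
  simp [Act.eval, Act.silent]

/-- A concrete action as an action term. -/
def Act.ofGround (c : 𝔸.GroundAct) : Act 𝔸 X := ⟨c.1, c.2.map Expr.val⟩

theorem Act.eval_ofGround (ρ : X → 𝔸.Val) (c : 𝔸.GroundAct) : (Act.ofGround c).eval ρ = c := by
  obtain ⟨l, as⟩ := c
  simp [Act.eval, Act.ofGround, Function.comp_def, Expr.eval]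

theorem Act.sig_ofGround_eval (ρ : Y → 𝔸.Val) (a : Act 𝔸 Y) :
    (Act.ofGround (a.eval ρ) : Act 𝔸 X).sig = a.sig := by
  simp [Act.sig, Act.ofGround, Act.eval]

open Classical in
/-- The sequence of visible actions of a hole, for concrete actions. -/
noncomputable def groundVisible : Option 𝔸.GroundAct → List 𝔸.GroundAct
  | none => []
  | some c => if c = 𝔸.groundTau then [] else [c]

theorem visible_map_eval (ρ : X → 𝔸.Val) (o : Option (Act 𝔸 X)) :
    (visible o).map (Act.eval ρ) = groundVisible (o.map (Act.eval ρ)) := by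
  cases o with
  | none => rfl
  | some b => by_cases h : b = Act.silent <;> simp [visible, groundVisible, Act.eval_eq_groundTau, h]

theorem groundVisible_eq_nil {o : Option 𝔸.GroundAct} :
    groundVisible o = [] ↔ o = none ∨ o = some 𝔸.groundTau := by
  cases o with
  | none => simp [groundVisible]
  | some c => by_cases h : c = 𝔸.groundTau <;> simp [groundVisible, h]

theorem groundVisible_eq_singleton {o : Option 𝔸.GroundAct} {c : 𝔸.GroundAct}
    (h : groundVisible o = [c]) : o = some c := by
  cases o with
  | none => simp [groundVisible] at h
  | some d => by_cases hd : d = 𝔸.groundTau <;> simp_all [groundVisible]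

theorem visible_ne_nil {o : Option (Act 𝔸 X)} :
    visible o ≠ [] ↔ ∃ b, o = some b ∧ b ≠ Act.silent := by
  cases o with
  | none => simp [visible]
  | some b => by_cases h : b = Act.silent <;> simp [visible, h]

/-- On valuations, `localSubst` changes only the local half and `postSubst` only the state half.
Refinement thus becomes a change of `φ`, and sequencing a change of `ρ` at constant `φ`. -/
theorem eval_localSubst {V : Type u} (θ : 𝔸.LocalVar → Expr 𝔸 (V ⊕ 𝔸.LocalVar))
    (ρ : V → 𝔸.Val) (φ : 𝔸.LocalVar → 𝔸.Val) :
    (fun x => (localSubst θ x).eval (Sum.elim ρ φ)) =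
      Sum.elim ρ (fun x => (θ x).eval (Sum.elim ρ φ)) := by
  funext x; cases x <;> rfl

theorem eval_postSubst {V : Type u} (post : V → Expr 𝔸 (V ⊕ 𝔸.LocalVar))
    (ρ : V → 𝔸.Val) (φ : 𝔸.LocalVar → 𝔸.Val) :
    (fun x => (postSubst post x).eval (Sum.elim ρ φ)) =
      Sum.elim (fun v => (post v).eval (Sum.elim ρ φ)) φ := by
  funext x; cases x <;> rfl

theorem eval_postComp {V : Type u} (post₂ post₁ : V → Expr 𝔸 (V ⊕ 𝔸.LocalVar))
    (ρ : V → 𝔸.Val) (φ : 𝔸.LocalVar → 𝔸.Val) (v : V) :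
    (postComp post₂ post₁ v).eval (Sum.elim ρ φ) =
      (post₂ v).eval (Sum.elim (fun v => (post₁ v).eval (Sum.elim ρ φ)) φ) := by
  rw [postComp, Expr.eval_subst, eval_postSubst]

theorem elim_sigma_mk {I : Type u} {V : I → Type u} (ρ : (Σ i, V i) → 𝔸.Val)
    (φ : 𝔸.LocalVar → 𝔸.Val) (i : I) :
    (fun x : V i ⊕ 𝔸.LocalVar => Sum.elim ρ φ (Sum.map (Sigma.mk i) id x)) =
      Sum.elim (fun v => ρ ⟨i, v⟩) φ := by
  funext x; cases x <;> rfl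

end Evaluation

/-! ### Concrete transitions -/

section Ground

variable {𝔸 : TermAlgebra.{u}} {V S : Type u}

/-- `t` has an instance from state `s` with values `ρ` to state `s'` with values `ρ'`, with the
concrete action `a` and the concrete actions `b` of the holes; the values of the local variables
are `φ`. -/
structure OpenTransition.HasInstance (t : OpenTransition 𝔸 V S) (φ : 𝔸.LocalVar → 𝔸.Val)
    (s : S) (ρ : V → 𝔸.Val) (b : 𝔸.Hole → Option 𝔸.GroundAct) (a : 𝔸.GroundAct) (s' : S)
    (ρ' : V → 𝔸.Val) : Prop where
  src : t.src = s
  tgt : t.tgt = s'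
  pred : t.pred (Sum.elim ρ φ)
  β : ∀ h, b h = (t.β h).map (Act.eval (Sum.elim ρ φ))
  act : t.act.eval (Sum.elim ρ φ) = a
  post : ∀ v, (t.post v).eval (Sum.elim ρ φ) = ρ' v

/-- The concrete instances of a set of open transitions. -/
def GroundStep (T : Set (OpenTransition 𝔸 V S)) (s : S) (ρ : V → 𝔸.Val)
    (b : 𝔸.Hole → Option 𝔸.GroundAct) (a : 𝔸.GroundAct) (s' : S) (ρ' : V → 𝔸.Val) : Prop :=
  ∃ t ∈ T, ∃ φ, t.HasInstance φ s ρ b a s' ρ'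

variable {T : Set (OpenTransition 𝔸 V S)} {s s' : S} {ρ ρ' : V → 𝔸.Val}
  {b : 𝔸.Hole → Option 𝔸.GroundAct} {a : 𝔸.GroundAct}

theorem OpenTransition.hasInstance_refine {t : OpenTransition 𝔸 V S}
    {θ : 𝔸.LocalVar → Expr 𝔸 (V ⊕ 𝔸.LocalVar)} {p : Pred 𝔸 (V ⊕ 𝔸.LocalVar)}
    {φ : 𝔸.LocalVar → 𝔸.Val} :
    (t.refine θ p).HasInstance φ s ρ b a s' ρ' ↔
      t.HasInstance (fun x => (θ x).eval (Sum.elim ρ φ)) s ρ b a s' ρ' ∧ p (Sum.elim ρ φ) := by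
  have hβ : ∀ h, ((t.refine θ p).β h).map (Act.eval (Sum.elim ρ φ)) =
      (t.β h).map (Act.eval (Sum.elim ρ (fun x => (θ x).eval (Sum.elim ρ φ)))) := by
    intro h
    simp [OpenTransition.refine, Function.comp_def, Act.eval_subst, eval_localSubst]
  have ha : (t.refine θ p).act.eval (Sum.elim ρ φ) =
      t.act.eval (Sum.elim ρ (fun x => (θ x).eval (Sum.elim ρ φ))) := by
    simp [OpenTransition.refine, Act.eval_subst, eval_localSubst]
  have hp : ∀ v, ((t.refine θ p).post v).eval (Sum.elim ρ φ) =
      (t.post v).eval (Sum.elim ρ (fun x => (θ x).eval (Sum.elim ρ φ))) := by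
    intro v
    simp [OpenTransition.refine, Expr.eval_subst, eval_localSubst]
  have hr : (t.refine θ p).pred (Sum.elim ρ φ) ↔
      t.pred (Sum.elim ρ (fun x => (θ x).eval (Sum.elim ρ φ))) ∧ p (Sum.elim ρ φ) := by
    simp [OpenTransition.refine, Pred.subst, eval_localSubst]
  constructor
  · rintro ⟨h₁, h₂, h₃, h₄, h₅, h₆⟩
    exact ⟨⟨h₁, h₂, (hr.1 h₃).1, fun h => (h₄ h).trans (hβ h), ha ▸ h₅,
      fun v => (hp v).symm.trans (h₆ v)⟩, (hr.1 h₃).2⟩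
  · rintro ⟨⟨h₁, h₂, h₃, h₄, h₅, h₆⟩, h₇⟩
    exact ⟨h₁, h₂, hr.2 ⟨h₃, h₇⟩, fun h => (h₄ h).trans (hβ h).symm, ha.trans h₅,
      fun v => (hp v).trans (h₆ v)⟩

/-- Substituting values for the local variables makes an instance independent of their values. -/
theorem GroundStep.exists_uniform (hT : ∀ t ∈ T, ∀ θ p, t.refine θ p ∈ T)
    (h : GroundStep T s ρ b a s' ρ') : ∃ t ∈ T, ∀ φ, t.HasInstance φ s ρ b a s' ρ' := by
  obtain ⟨t, ht, φ, hφ⟩ := h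
  exact ⟨t.refine (fun x => Expr.val (φ x)) (fun _ => True), hT t ht _ _,
    fun ψ => OpenTransition.hasInstance_refine.2 ⟨hφ, trivial⟩⟩

/-- An instance of a refinement is an instance of the original transition for other local values, so
the closure adds no concrete steps. -/
theorem groundStep_refinements :
    GroundStep {t | Refinements T t} s ρ b a s' ρ' ↔ GroundStep T s ρ b a s' ρ' := by
  constructor
  · rintro ⟨t, ht, φ, hφ⟩
    replace ht : Refinements T t := ht
    induction ht generalizing φ with
    | base t ht => exact ⟨t, ht, φ, hφ⟩
    | refine t θ p _ ih => exact ih _ (OpenTransition.hasInstance_refine.1 hφ).1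
  · rintro ⟨t, ht, φ, hφ⟩
    exact ⟨t, Refinements.base t ht, φ, hφ⟩

/-! ### Concrete weak transitions and their correspondence with the symbolic ones. -/

/-- The concrete weak transitions. -/
inductive GroundWeak (T : Set (OpenTransition 𝔸 V S)) : S → (V → 𝔸.Val) →
    (𝔸.Hole → List 𝔸.GroundAct) → 𝔸.GroundAct → S → (V → 𝔸.Val) → Prop
  | stay (s : S) (ρ : V → 𝔸.Val) : GroundWeak T s ρ (fun _ => []) 𝔸.groundTau s ρ
  | step {s s' : S} {ρ ρ' : V → 𝔸.Val} {b : 𝔸.Hole → Option 𝔸.GroundAct} {a : 𝔸.GroundAct}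
      (h : GroundStep T s ρ b a s' ρ') : GroundWeak T s ρ (fun h => groundVisible (b h)) a s' ρ'
  | seq {s₀ s₁ s₂ s₃ : S} {ρ₀ ρ₁ ρ₂ ρ₃ : V → 𝔸.Val} {γ₁ γ₂ γ₃ : 𝔸.Hole → List 𝔸.GroundAct}
      {a : 𝔸.GroundAct} (h₁ : GroundWeak T s₀ ρ₀ γ₁ 𝔸.groundTau s₁ ρ₁)
      (h₂ : GroundWeak T s₁ ρ₁ γ₂ a s₂ ρ₂) (h₃ : GroundWeak T s₂ ρ₂ γ₃ 𝔸.groundTau s₃ ρ₃) :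
      GroundWeak T s₀ ρ₀ (fun h => γ₁ h ++ γ₂ h ++ γ₃ h) a s₃ ρ₃

/-- Instances of weak open transitions. -/
structure WeakOpenTransition.HasInstance (w : WeakOpenTransition 𝔸 V S) (φ : 𝔸.LocalVar → 𝔸.Val)
    (s : S) (ρ : V → 𝔸.Val) (γ : 𝔸.Hole → List 𝔸.GroundAct) (a : 𝔸.GroundAct) (s' : S)
    (ρ' : V → 𝔸.Val) : Prop where
  src : w.src = s
  tgt : w.tgt = s'
  pred : w.pred (Sum.elim ρ φ)
  γ : ∀ h, γ h = (w.γ h).map (Act.eval (Sum.elim ρ φ))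
  act : w.act.eval (Sum.elim ρ φ) = a
  post : ∀ v, (w.post v).eval (Sum.elim ρ φ) = ρ' v

theorem WeakOpenTransition.eval_seq_γ (w₁ w₂ w₃ : WeakOpenTransition 𝔸 V S) (ρ : V → 𝔸.Val)
    (φ : 𝔸.LocalVar → 𝔸.Val) (h : 𝔸.Hole) :
    ((w₁.seq w₂ w₃).γ h).map (Act.eval (Sum.elim ρ φ)) =
      (w₁.γ h).map (Act.eval (Sum.elim ρ φ)) ++
      (w₂.γ h).map (Act.eval (Sum.elim (fun v => (w₁.post v).eval (Sum.elim ρ φ)) φ)) ++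
      (w₃.γ h).map (Act.eval (Sum.elim (fun v => (w₂.post v).eval
        (Sum.elim (fun v => (w₁.post v).eval (Sum.elim ρ φ)) φ)) φ)) := by
  simp [WeakOpenTransition.seq, Function.comp_def, Act.eval_subst, eval_postSubst, eval_postComp]

theorem WeakOpenTransition.seq_pred (w₁ w₂ w₃ : WeakOpenTransition 𝔸 V S) (ρ : V → 𝔸.Val)
    (φ : 𝔸.LocalVar → 𝔸.Val) :
    (w₁.seq w₂ w₃).pred (Sum.elim ρ φ) ↔
      w₁.pred (Sum.elim ρ φ) ∧
      w₂.pred (Sum.elim (fun v => (w₁.post v).eval (Sum.elim ρ φ)) φ) ∧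
      w₃.pred (Sum.elim (fun v => (w₂.post v).eval
        (Sum.elim (fun v => (w₁.post v).eval (Sum.elim ρ φ)) φ)) φ) := by
  simp [WeakOpenTransition.seq, Pred.subst, eval_postSubst, eval_postComp]

theorem WeakOpenTransition.eval_seq_act (w₁ w₂ w₃ : WeakOpenTransition 𝔸 V S) (ρ : V → 𝔸.Val)
    (φ : 𝔸.LocalVar → 𝔸.Val) :
    (w₁.seq w₂ w₃).act.eval (Sum.elim ρ φ) =
      w₂.act.eval (Sum.elim (fun v => (w₁.post v).eval (Sum.elim ρ φ)) φ) := by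
  simp [WeakOpenTransition.seq, Act.eval_subst, eval_postSubst]

theorem WeakOpenTransition.eval_seq_post (w₁ w₂ w₃ : WeakOpenTransition 𝔸 V S) (ρ : V → 𝔸.Val)
    (φ : 𝔸.LocalVar → 𝔸.Val) (v : V) :
    ((w₁.seq w₂ w₃).post v).eval (Sum.elim ρ φ) =
      (w₃.post v).eval (Sum.elim (fun v => (w₂.post v).eval
        (Sum.elim (fun v => (w₁.post v).eval (Sum.elim ρ φ)) φ)) φ) := by
  simp [WeakOpenTransition.seq, eval_postComp]

variable {A B : OpenAutomaton 𝔸}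

theorem OpenAutomaton.WeakTrans.groundWeak {w : WeakOpenTransition 𝔸 A.Vars A.State}
    (hw : A.WeakTrans w) (φ : 𝔸.LocalVar → 𝔸.Val) :
    ∀ {ρ : A.Vars → 𝔸.Val}, w.pred (Sum.elim ρ φ) →
      GroundWeak A.trans w.src ρ (fun h => (w.γ h).map (Act.eval (Sum.elim ρ φ)))
        (w.act.eval (Sum.elim ρ φ)) w.tgt (fun v => (w.post v).eval (Sum.elim ρ φ)) := by
  induction hw with
  | stay s => exact fun {ρ} _ => GroundWeak.stay s ρ
  | ofOpen t ht =>
    intro ρ hp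
    simp only [WeakOpenTransition.ofOpen, visible_map_eval]
    exact GroundWeak.step (b := fun h => (t.β h).map (Act.eval (Sum.elim ρ φ)))
      ⟨t, ht, φ, rfl, rfl, hp, fun _ => rfl, rfl, fun _ => rfl⟩
  | seq w₁ w₂ w₃ _ _ _ h₁₂ h₂₃ hτ₁ hτ₃ ih₁ ih₂ ih₃ =>
    intro ρ hp
    obtain ⟨hp₁, hp₂, hp₃⟩ := (WeakOpenTransition.seq_pred w₁ w₂ w₃ ρ φ).1 hp
    have g₁ := ih₁ hp₁
    have g₂ := ih₂ hp₂
    have g₃ := ih₃ hp₃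
    rw [hτ₁, h₁₂, Act.eval_silent] at g₁
    rw [h₂₃] at g₂
    rw [hτ₃, Act.eval_silent] at g₃
    simp only [WeakOpenTransition.eval_seq_γ, WeakOpenTransition.eval_seq_act,
      WeakOpenTransition.eval_seq_post]
    exact GroundWeak.seq g₁ g₂ g₃

/-- The quantifier over all `φ` is what makes the induction work: `seq` shares the local variables
of its three parts, so parts instantiated at different valuations could not be composed. -/
theorem GroundWeak.exists_weakTrans {s s' : A.State} {ρ ρ' : A.Vars → 𝔸.Val}
    {γ : 𝔸.Hole → List 𝔸.GroundAct} (h : GroundWeak A.trans s ρ γ a s' ρ') :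
    ∃ w, A.WeakTrans w ∧ ∀ φ, w.HasInstance φ s ρ γ a s' ρ' := by
  induction h with
  | stay s ρ =>
    exact ⟨_, OpenAutomaton.WeakTrans.stay s,
      fun φ => ⟨rfl, rfl, trivial, fun _ => rfl, rfl, fun _ => rfl⟩⟩
  | step h =>
    obtain ⟨t, ht, hφ⟩ := h.exists_uniform A.trans_refine
    refine ⟨_, OpenAutomaton.WeakTrans.ofOpen t ht, fun φ => ⟨(hφ φ).src, (hφ φ).tgt, (hφ φ).pred,
      fun h => ?_, (hφ φ).act, (hφ φ).post⟩⟩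
    rw [(hφ φ).β h]
    exact (visible_map_eval _ _).symm
  | seq _ _ _ ih₁ ih₂ ih₃ =>
    obtain ⟨w₁, hw₁, g₁⟩ := ih₁
    obtain ⟨w₂, hw₂, g₂⟩ := ih₂
    obtain ⟨w₃, hw₃, g₃⟩ := ih₃
    -- States and silence do not depend on the local values, so any valuation serves to read them
    -- off.
    let φ₀ : 𝔸.LocalVar → 𝔸.Val := fun _ => 𝔸.tt
    refine ⟨_, OpenAutomaton.WeakTrans.seq w₁ w₂ w₃ hw₁ hw₂ hw₃
      ((g₁ φ₀).tgt.trans (g₂ φ₀).src.symm) ((g₂ φ₀).tgt.trans (g₃ φ₀).src.symm)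
      (Act.eval_eq_groundTau.1 (g₁ φ₀).act) (Act.eval_eq_groundTau.1 (g₃ φ₀).act), fun φ => ?_⟩
    have e₁ := funext (g₁ φ).post
    have e₂ := funext (g₂ φ).post
    refine ⟨(g₁ φ).src, (g₃ φ).tgt, ?_, fun h => ?_, ?_, fun v => ?_⟩
    · rw [WeakOpenTransition.seq_pred, e₁, e₂]
      exact ⟨(g₁ φ).pred, (g₂ φ).pred, (g₃ φ).pred⟩
    · rw [WeakOpenTransition.eval_seq_γ, e₁, e₂, (g₁ φ).γ, (g₂ φ).γ, (g₃ φ).γ]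
    · rw [WeakOpenTransition.eval_seq_act, e₁, (g₂ φ).act]
    · rw [WeakOpenTransition.eval_seq_post, e₁, e₂, (g₃ φ).post]

/-! ### Symbolic and concrete simulations. -/

/-- Weak simulations between the concrete instances of two sets of open transitions. -/
def GroundSimulation {V S V' S' : Type u} (T : Set (OpenTransition 𝔸 V S))
    (T' : Set (OpenTransition 𝔸 V' S')) (R : S → S' → (V → 𝔸.Val) → (V' → 𝔸.Val) → Prop) : Prop :=
  ∀ s t ρ₁ ρ₂ b a s' ρ₁', R s t ρ₁ ρ₂ → GroundStep T s ρ₁ b a s' ρ₁' →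
    ∃ t' ρ₂', GroundWeak T' t ρ₂ (fun h => groundVisible (b h)) a t' ρ₂' ∧ R s' t' ρ₁' ρ₂'

/-- Weak simulation in terms of concrete transitions. -/
theorem weakSimulation_iff {R : StateRel A B} :
    WeakSimulation A B R ↔ GroundSimulation A.trans B.trans R := by
  constructor
  · rintro hsim s t ρ₁ ρ₂ b a s' ρ₁' hR ⟨o, ho, φ, hφ⟩
    obtain ⟨X, hX, hX'⟩ := hsim s t o ho hφ.src
    obtain ⟨w, hw, hγ, hp, ha, hR'⟩ := hX' ρ₁ ρ₂ φ hR hφ.pred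
    obtain ⟨hwt, rfl, -⟩ := hX w hw
    refine ⟨w.tgt, _, ?_, by rw [hφ.tgt, funext hφ.post] at hR'; exact hR'⟩
    have := hwt.groundWeak φ hp
    rw [← ha, hφ.act] at this
    convert this using 1
    funext h
    rw [← hγ h, hφ.β h, visible_map_eval]
  · intro hsim s t o ho hs
    -- The largest admissible family: the disjunction over it is plain existence of an answer for
    -- each valuation.
    refine ⟨{w | B.WeakTrans w ∧ w.src = t ∧
        {j | ∃ b, o.β j = some b ∧ b ≠ Act.silent} = {j | w.γ j ≠ []}}, fun w hw => hw, ?_⟩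
    intro ρ₁ ρ₂ φ hR hp
    obtain ⟨t', ρ₂', hw, hR'⟩ := hsim s t ρ₁ ρ₂ (fun h => (o.β h).map (Act.eval (Sum.elim ρ₁ φ)))
      _ _ _ hR ⟨o, ho, φ, hs, rfl, hp, fun _ => rfl, rfl, fun _ => rfl⟩
    obtain ⟨w, hwt, hi⟩ := hw.exists_weakTrans
    -- Both sides must be evaluated at the same `φ`; this is possible because `w` has the instance
    -- at every `φ`.
    have hi := hi φ
    have hγ : ∀ j, (visible (o.β j)).map (Act.eval (Sum.elim ρ₁ φ)) =
        (w.γ j).map (Act.eval (Sum.elim ρ₂ φ)) := fun j => by rw [visible_map_eval, hi.γ j]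
    refine ⟨w, ⟨hwt, hi.src, ?_⟩, hγ, hi.pred, hi.act.symm, ?_⟩
    · ext j
      have := congrArg List.length (hγ j)
      rw [List.length_map, List.length_map] at this
      rw [Set.mem_ofPred_eq, Set.mem_ofPred_eq, ← visible_ne_nil, ← List.length_pos_iff,
        ← List.length_pos_iff, this]
    · rw [hi.tgt, funext hi.post]
      exact hR'

end Ground

/-! ### Concrete transitions of nodes -/

section Node

variable {𝔸 : TermAlgebra.{u}}

/-- A component of a node makes a concrete step with the action `c`, or is idle if there is no
action. -/
def GroundMove {V S : Type u} (T : Set (OpenTransition 𝔸 V S)) (c : Option 𝔸.GroundAct) (s : S)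
    (ρ : V → 𝔸.Val) (b : 𝔸.Hole → Option 𝔸.GroundAct) (s' : S) (ρ' : V → 𝔸.Val) : Prop :=
  (∃ a, c = some a ∧ GroundStep T s ρ b a s' ρ') ∨
    (c = none ∧ s' = s ∧ ρ' = ρ ∧ ∀ h, b h = none)

/-- The concrete version of the rule for nodes. -/
structure GroundNode {I : Type u} {V S : I → Type u} (subHoles : I → Set 𝔸.Hole)
    (T : (i : I) → Set (OpenTransition 𝔸 (V i) (S i))) (J : Set 𝔸.Hole) (sv : SyncVec 𝔸 I)
    (ν : 𝔸.LocalVar → 𝔸.Val) (β : I → 𝔸.Hole → Option 𝔸.GroundAct) (s : (i : I) → S i)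
    (ρ : (Σ i, V i) → 𝔸.Val) (b : 𝔸.Hole → Option 𝔸.GroundAct) (a : 𝔸.GroundAct)
    (s' : (i : I) → S i) (ρ' : (Σ i, V i) → 𝔸.Val) : Prop where
  move : ∀ i, GroundMove (T i) ((sv.sub i).map (Act.eval ν)) (s i) (fun v => ρ ⟨i, v⟩) (β i) (s' i)
    (fun v => ρ' ⟨i, v⟩)
  hole : ∀ j ∈ J, b j = (sv.hole j).map (Act.eval ν)
  subHole : ∀ i, ∀ h ∈ subHoles i, b h = β i h
  noHole : ∀ h, h ∉ J → (∀ i, h ∉ subHoles i) → b h = none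
  act : a = sv.act.eval ν
  guard : sv.guard.Holds ν

variable {I : Type u} {V S : I → Type u} {subHoles : I → Set 𝔸.Hole}
  {T : (i : I) → Set (OpenTransition 𝔸 (V i) (S i))} {J : Set 𝔸.Hole}
  {sort : J → Set 𝔸.Signature} {sv : SyncVec 𝔸 I} {s s' : (i : I) → S i}
  {ρ ρ' : (Σ i, V i) → 𝔸.Val} {b : 𝔸.Hole → Option 𝔸.GroundAct} {a : 𝔸.GroundAct}

theorem NodeRule.exists_groundNode {o : OpenTransition 𝔸 (Σ i, V i) ((i : I) → S i)}
    {φ : 𝔸.LocalVar → 𝔸.Val} (ho : NodeRule subHoles T J sort sv o)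
    (hφ : o.HasInstance φ s ρ b a s' ρ') :
    ∃ ν β, GroundNode subHoles T J sv ν β s ρ b a s' ρ' := by
  obtain ⟨t, ν, hT, hidle, hsrc, htgt, hact, -, hsub, hout, hpost, hpred⟩ := ho
  have hp := hφ.pred
  rw [hpred] at hp
  obtain ⟨hp₁, hp₂, hp₃, hp₄, hp₅⟩ := hp
  have hpost' : ∀ i v, ρ' ⟨i, v⟩ = ((t i).post v).eval (Sum.elim (fun v => ρ ⟨i, v⟩) φ) := by
    intro i v
    rw [← hφ.post, hpost, Expr.eval_rename, elim_sigma_mk]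
  refine ⟨fun x => (ν x).eval (Sum.elim ρ φ),
    fun i h => ((t i).β h).map (Act.eval (Sum.elim (fun v => ρ ⟨i, v⟩) φ)), ?_, ?_, ?_, ?_, ?_, ?_⟩
  · intro i
    cases hi : sv.sub i with
    | none =>
      obtain ⟨h₁, h₂, h₃, h₄⟩ := hidle i hi
      refine Or.inr ⟨rfl, ?_, ?_, fun h => by beta_reduce; rw [h₂]; rfl⟩
      · rw [← hφ.src, ← hφ.tgt, htgt, hsrc, h₁]
      · funext v
        rw [hpost', h₄]
        rfl
    | some α =>
      refine Or.inl ⟨_, rfl, t i, hT i (by simp [hi]), φ, ?_, ?_, ?_, fun _ => rfl, ?_,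
        fun v => (hpost' i v).symm⟩
      · rw [← hφ.src, hsrc]
      · rw [← hφ.tgt, htgt]
      · have := hp₁ i
        rwa [elim_sigma_mk] at this
      · have := hp₂ i α hi
        rwa [elim_sigma_mk, Act.eval_subst] at this
  · intro j hj
    have := hact ⟨j, hj⟩
    rw [hφ.β]
    cases h₁ : sv.hole j with
    | none =>
      cases h₂ : o.β j with
      | none => rfl
      | some c => simp [h₁, h₂] at this
    | some α =>
      cases h₂ : o.β j with
      | none => simp [h₁, h₂] at this
      | some c => simp [hp₃ j hj α c h₁ h₂, Act.eval_subst]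
  · intro i h hh
    rw [hφ.β, hsub i h hh, Option.map_map]
    congr 1
    funext c
    rw [Function.comp_apply, Act.eval_rename, elim_sigma_mk]
  · intro h h₁ h₂
    rw [hφ.β, hout h h₁ h₂]
    rfl
  · rw [← hφ.act, hp₄, Act.eval_subst]
  · have := hp₅
    rwa [Expr.Holds, Expr.eval_subst] at this

-- The transition is assembled from uniform transitions of the sub-pNets and from constants: the
-- values `ν` for the variables of the vector, and ground terms for the global action and the holes
-- in `J`. It therefore has the required instance for every `φ`.
open Classical in
theorem GroundNode.exists_nodeRule (hT : ∀ i, ∀ t ∈ T i, ∀ θ p, t.refine θ p ∈ T i)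
    (hJ : ∀ i, Disjoint (subHoles i) J) (hI : ∀ i i', i ≠ i' → Disjoint (subHoles i) (subHoles i'))
    (hsv : ∀ j a, sv.hole j = some a → ∃ hj : j ∈ J, a.sig ∈ sort ⟨j, hj⟩)
    {ν : 𝔸.LocalVar → 𝔸.Val} {β : I → 𝔸.Hole → Option 𝔸.GroundAct}
    (hg : GroundNode subHoles T J sv ν β s ρ b a s' ρ') :
    ∃ o, NodeRule subHoles T J sort sv o ∧ ∀ φ, o.HasInstance φ s ρ b a s' ρ' := by
  -- The action of an idle component is irrelevant; `groundTau` is a default matching the dummy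
  -- transition chosen below.
  have hmove : ∀ i, ∃ t : OpenTransition 𝔸 (V i) (S i),
      (∀ φ, t.HasInstance φ (s i) (fun v => ρ ⟨i, v⟩) (β i)
        (((sv.sub i).map (Act.eval ν)).getD 𝔸.groundTau) (s' i) (fun v => ρ' ⟨i, v⟩)) ∧
      ((sv.sub i).isSome → t ∈ T i) ∧ (sv.sub i = none → t.IsIdle) := by
    intro i
    rcases hg.move i with ⟨c, hc, hs⟩ | ⟨hc, hs, hρ, hβ⟩
    · obtain ⟨t, ht, hφ⟩ := hs.exists_uniform (hT i)
      refine ⟨t, fun φ => by simpa [hc] using hφ φ, fun _ => ht, fun h => ?_⟩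
      rw [h] at hc
      cases hc
    · have hn : sv.sub i = none := by simpa using hc
      refine ⟨⟨s i, s i, fun _ => none, Act.silent, fun _ => True, idPost⟩, fun φ => ?_, fun h => ?_,
        fun _ => ⟨rfl, fun _ => rfl, fun _ => trivial, rfl⟩⟩
      · refine ⟨rfl, hs.symm, trivial, fun h => by rw [hβ]; rfl, ?_, fun v => ?_⟩
        · rw [hc]; rfl
        · exact (congrFun hρ v).symm
      · rw [hn] at h
        cases h
  choose t ht hmem hidle using hmove
  let o : OpenTransition 𝔸 (Σ i, V i) ((i : I) → S i) :=
    { src := s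
      tgt := s'
      β := fun h => if h ∈ J then (b h).map Act.ofGround else
        if hi : ∃ i, h ∈ subHoles i then
          ((t hi.choose).β h).map (Act.rename (Sum.map (Sigma.mk hi.choose) id))
        else none
      act := Act.ofGround a
      pred := fun ρ => (∀ i, (t i).pred (fun x => ρ (Sum.map (Sigma.mk i) id x))) ∧
        (∀ i a, sv.sub i = some a → (t i).act.eval (fun x => ρ (Sum.map (Sigma.mk i) id x)) =
          (a.subst (fun x => Expr.val (ν x))).eval ρ) ∧
        (∀ j ∈ J, ∀ a c, sv.hole j = some a → (b j).map Act.ofGround = some c →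
          c.eval ρ = (a.subst (fun x => Expr.val (ν x))).eval ρ) ∧
        (Act.ofGround a).eval ρ = (sv.act.subst (fun x => Expr.val (ν x))).eval ρ ∧
        (sv.guard.subst (fun x => Expr.val (ν x))).Holds ρ
      post := fun v => ((t v.1).post v.2).rename (Sum.map (Sigma.mk v.1) id) }
  have hoJ : ∀ h ∈ J, o.β h = (b h).map Act.ofGround := fun h hh => if_pos hh
  have hoI : ∀ i, ∀ h ∈ subHoles i,
      o.β h = ((t i).β h).map (Act.rename (Sum.map (Sigma.mk i) id)) := by
    intro i h hh
    have hn : h ∉ J := Set.disjoint_left.1 (hJ i) hh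
    have hex : ∃ i, h ∈ subHoles i := ⟨i, hh⟩
    -- A hole belongs to at most one sub-pNet, so the choice made in `o.β` is forced.
    have he : hex.choose = i := by
      by_contra hne
      exact Set.disjoint_left.1 (hI _ _ hne) hex.choose_spec hh
    have : o.β h = ((t hex.choose).β h).map (Act.rename (Sum.map (Sigma.mk hex.choose) id)) :=
      (if_neg hn).trans (dif_pos hex)
    rw [this, he]
  have hout : ∀ h, h ∉ J → (∀ i, h ∉ subHoles i) → o.β h = none := by
    intro h h₁ h₂
    exact (if_neg h₁).trans (dif_neg (by simpa using h₂))
  refine ⟨o, ⟨t, fun x => Expr.val (ν x), hmem, hidle, fun i => ((ht i (fun _ => 𝔸.tt)).src).symm,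
    fun i => ((ht i (fun _ => 𝔸.tt)).tgt).symm, fun j => ?_, fun j c hc => ?_, hoI, hout,
    fun _ _ => rfl, ?_⟩, fun φ => ⟨rfl, rfl, ⟨fun i => ?_, fun i α hα => ?_, ?_, ?_, ?_⟩,
    fun h => ?_, Act.eval_ofGround _ _, fun v => ?_⟩⟩
  · rw [hoJ j j.2, hg.hole j j.2]
    simp
  · rw [hoJ j j.2, hg.hole j j.2, Option.map_map, Option.map_eq_some_iff] at hc
    obtain ⟨α, hα, rfl⟩ := hc
    obtain ⟨_, hs⟩ := hsv j α hα
    rw [Function.comp_apply, Act.sig_ofGround_eval]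
    exact hs
  -- The predicate in `o` is written with `(b j).map Act.ofGround` because `o` cannot mention its
  -- own `β`; the two agree on `J`.
  · funext σ
    refine congrArg (_ ∧ ·) (congrArg (_ ∧ ·) (congrArg (· ∧ _) ?_))
    refine forall_congr fun j => forall_congr fun hj => ?_
    rw [hoJ j hj]
  · rw [elim_sigma_mk]
    exact (ht i φ).pred
  · rw [elim_sigma_mk, (ht i φ).act, hα, Act.eval_subst]
    rfl
  · intro j hj α c hα hc
    rw [hg.hole j hj, hα] at hc
    simp only [Option.map_some, Option.some.injEq] at hc
    rw [← hc, Act.eval_ofGround, Act.eval_subst]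
    rfl
  · rw [Act.eval_ofGround, hg.act, Act.eval_subst]
    rfl
  · rw [Expr.Holds, Expr.eval_subst]
    exact hg.guard
  · by_cases hJh : h ∈ J
    · rw [hoJ h hJh, Option.map_map]
      simp [Function.comp_def, Act.eval_ofGround]
    · by_cases hIh : ∃ i, h ∈ subHoles i
      · obtain ⟨i, hi⟩ := hIh
        rw [hoI i h hi, hg.subHole i h hi, (ht i φ).β, Option.map_map]
        congr 1
        funext c
        rw [Function.comp_apply, Act.eval_rename, elim_sigma_mk]
      · have hIh' : ∀ i, h ∉ subHoles i := by simpa using hIh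
        rw [hout h hJh hIh', hg.noHole h hJh hIh']
        rfl
  · show Expr.eval _ (Expr.rename _ _) = _
    rw [Expr.eval_rename, elim_sigma_mk]
    exact (ht v.1 φ).post v.2

/-- The side conditions on the holes of a node that its semantics depends on. -/
structure PNet.HoleConditions {I K : Type u} (subHoles : I → Set 𝔸.Hole) (J : Set 𝔸.Hole)
    (sort : J → Set 𝔸.Signature) (SV : K → SyncVec 𝔸 I) : Prop where
  disjoint : ∀ i, Disjoint (subHoles i) J
  pairwise : ∀ i i', i ≠ i' → Disjoint (subHoles i) (subHoles i')
  sig_mem : ∀ k j a, (SV k).hole j = some a → ∃ hj : j ∈ J, a.sig ∈ sort ⟨j, hj⟩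

/-- The open transitions of a node. -/
def PNet.nodeTrans {I K : Type u} (sub : I → PNet 𝔸) (J : Set 𝔸.Hole)
    (sort : J → Set 𝔸.Signature) (SV : K → SyncVec 𝔸 I) :
    Set (OpenTransition 𝔸 (Σ i, (sub i).Vars) ((i : I) → (sub i).State)) :=
  (PNet.node I sub J sort K SV).trans

/-- Everything about compositions goes through this equivalence; symbolic predicates and assignments
are not needed beyond it. -/
theorem groundStep_node_iff {I K : Type u} {sub : I → PNet 𝔸} {J : Set 𝔸.Hole}
    {sort : J → Set 𝔸.Signature} {SV : K → SyncVec 𝔸 I}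
    (hc : PNet.HoleConditions (fun i => (sub i).holes) J sort SV)
    {s s' : (i : I) → (sub i).State} {ρ ρ' : (Σ i, (sub i).Vars) → 𝔸.Val}
    {b : 𝔸.Hole → Option 𝔸.GroundAct} {a : 𝔸.GroundAct} :
    GroundStep (PNet.nodeTrans sub J sort SV) s ρ b a s' ρ' ↔
      ∃ k ν β, GroundNode (fun i => (sub i).holes) (fun i => (sub i).trans) J (SV k) ν β
        s ρ b a s' ρ' := by
  refine groundStep_refinements.trans ⟨?_, ?_⟩
  · rintro ⟨o, ⟨k, ho⟩, φ, hφ⟩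
    obtain ⟨ν, β, h⟩ := ho.exists_groundNode hφ
    exact ⟨k, ν, β, h⟩
  · rintro ⟨k, ν, β, h⟩
    obtain ⟨o, ho, hφ⟩ := h.exists_nodeRule (fun i => (sub i).trans_refine) hc.disjoint hc.pairwise
      (hc.sig_mem k)
    exact ⟨o, ⟨k, ho⟩, fun _ => 𝔸.tt, hφ _⟩

end Node

/-! ### Concrete transitions of compositions -/

section Fill

variable {𝔸 : TermAlgebra.{u}} {I I' K K' : Type u}

open Classical in
/-- The synchronisation vector of `P[Q]_{j₀}` that corresponds to a vector of `P`. -/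
noncomputable def SyncVec.fill (sv : SyncVec 𝔸 I) (j₀ : 𝔸.Hole) : SyncVec 𝔸 (Option I) where
  sub := fun o => o.elim (sv.hole j₀) sv.sub
  hole := fun j => if j = j₀ then none else sv.hole j
  act := sv.act
  guard := sv.guard

/-- The sub-pNets of `P[Q]_{j₀}`. -/
def PNet.fillSub (Q : PNet 𝔸) (sub : I → PNet 𝔸) : Option I → PNet 𝔸 := fun o => o.elim Q sub

/-- The open transitions of `P[Q]_{j₀}`. -/
noncomputable def PNet.fillTrans (sub : I → PNet 𝔸) (J : Set 𝔸.Hole) (sort : J → Set 𝔸.Signature)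
    (SV : K → SyncVec 𝔸 I) (j₀ : 𝔸.Hole) (Q : PNet 𝔸) :
    Set (OpenTransition 𝔸 (Σ o, (PNet.fillSub Q sub o).Vars)
      ((o : Option I) → (PNet.fillSub Q sub o).State)) :=
  PNet.nodeTrans (PNet.fillSub Q sub) (J \ {j₀}) (fun j => sort ⟨j.1, j.2.1⟩)
    (fun k => (SV k).fill j₀)

/-- The state of `P[Q]_{j₀}` with given components. -/
def fillState {Q : PNet 𝔸} {sub : I → PNet 𝔸} (q : Q.State) (s : (i : I) → (sub i).State) :
    (o : Option I) → (PNet.fillSub Q sub o).State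
  | none => q
  | some i => s i

/-- The valuation of the variables of `P[Q]_{j₀}` with given components. -/
def fillVal {Q : PNet 𝔸} {sub : I → PNet 𝔸} (σ : Q.Vars → 𝔸.Val)
    (ρ : (Σ i, (sub i).Vars) → 𝔸.Val) : (Σ o, (PNet.fillSub Q sub o).Vars) → 𝔸.Val
  | ⟨none, v⟩ => σ v
  | ⟨some i, v⟩ => ρ ⟨i, v⟩

section Components

variable {Q : PNet 𝔸} {sub : I → PNet 𝔸}

/-- The component `Q` of a state of `P[Q]_{j₀}`. -/
def fillState.inner (s : (o : Option I) → (PNet.fillSub Q sub o).State) : Q.State := s none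

/-- The component `P` of a state of `P[Q]_{j₀}`. -/
def fillState.outer (s : (o : Option I) → (PNet.fillSub Q sub o).State) (i : I) : (sub i).State :=
  s (some i)

/-- The values of the variables of `Q`. -/
def fillVal.inner (ρ : (Σ o, (PNet.fillSub Q sub o).Vars) → 𝔸.Val) (v : Q.Vars) : 𝔸.Val :=
  ρ ⟨none, v⟩

/-- The values of the variables of `P`. -/
def fillVal.outer (ρ : (Σ o, (PNet.fillSub Q sub o).Vars) → 𝔸.Val) (v : Σ i, (sub i).Vars) :
    𝔸.Val :=
  ρ ⟨some v.1, v.2⟩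

theorem fillState_eta (s : (o : Option I) → (PNet.fillSub Q sub o).State) :
    fillState (fillState.inner s) (fillState.outer s) = s := by
  funext o; cases o <;> rfl

theorem fillVal_eta (ρ : (Σ o, (PNet.fillSub Q sub o).Vars) → 𝔸.Val) :
    fillVal (fillVal.inner ρ) (fillVal.outer ρ) = ρ := by
  funext v
  obtain ⟨o, v⟩ := v
  cases o <;> rfl

end Components

open Classical in
/-- The family equal to `f` on `H` and to `g` elsewhere, except for the value `d` at `j₀`. -/
noncomputable def mergeHoles {X : Type u} (H : Set 𝔸.Hole) (j₀ : 𝔸.Hole) (d : X)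
    (f g : 𝔸.Hole → X) (h : 𝔸.Hole) : X :=
  if h ∈ H then f h else if h = j₀ then d else g h

/-- In a composition `f` comes from `Q` and `g` from `P`. Membership in `H` is tested first because
`Q` may itself have a hole named `j₀`; otherwise `j₀` has been filled and shows nothing. -/
theorem groundVisible_mergeHoles (H : Set 𝔸.Hole) (j₀ : 𝔸.Hole)
    (f g : 𝔸.Hole → Option 𝔸.GroundAct) :
    (fun h => groundVisible (mergeHoles H j₀ none f g h)) =
      mergeHoles H j₀ [] (fun h => groundVisible (f h)) (fun h => groundVisible (g h)) := by
  funext h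
  unfold mergeHoles
  split_ifs <;> rfl

/-- Conditions under which `P[Q]_{j₀}` is a pNet, for a node `P` that cannot observe the silent
actions of the hole `j₀`. -/
structure PNet.FillConditions (sub : I → PNet 𝔸) (J : Set 𝔸.Hole) (sort : J → Set 𝔸.Signature)
    (SV : K → SyncVec 𝔸 I) (j₀ : 𝔸.Hole) (Q : PNet 𝔸) : Prop where
  hole : PNet.HoleConditions (fun i => (sub i).holes) J sort SV
  mem : j₀ ∈ J
  disjoint : Disjoint Q.holes ((J ∪ ⋃ i, (sub i).holes) \ {j₀})
  exists_tau : ∃ k, (∀ i, (SV k).sub i = none) ∧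
    (∀ j', (SV k).hole j' = some Act.silent ∧ j' = j₀ ∨ (SV k).hole j' = none ∧ j' ≠ j₀) ∧
    (SV k).act = Act.silent ∧ ∀ ρ, (SV k).guard.Holds ρ
  tau_only : ∀ k, (SV k).hole j₀ = some Act.silent → (SV k).act = Act.silent ∧
    (∀ i, (SV k).sub i = none) ∧ (∀ j', j' ≠ j₀ → (SV k).hole j' = none)

variable {sub : I → PNet 𝔸} {J : Set 𝔸.Hole} {sort : J → Set 𝔸.Signature} {SV : K → SyncVec 𝔸 I}
  {sub' : I' → PNet 𝔸} {SV' : K' → SyncVec 𝔸 I'} {j₀ : 𝔸.Hole} {Q : PNet 𝔸}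

namespace PNet.FillConditions

theorem notMem_of_mem_J (F : FillConditions sub J sort SV j₀ Q) {h : 𝔸.Hole} (hh : h ∈ J)
    (hne : h ≠ j₀) : h ∉ Q.holes :=
  Set.disjoint_right.1 F.disjoint ⟨Or.inl hh, hne⟩

theorem ne_of_mem_sub (F : FillConditions sub J sort SV j₀ Q) {h : 𝔸.Hole} {i : I}
    (hh : h ∈ (sub i).holes) : h ≠ j₀ := by
  rintro rfl
  exact Set.disjoint_left.1 (F.hole.disjoint i) hh F.mem

theorem notMem_of_mem_sub (F : FillConditions sub J sort SV j₀ Q) {h : 𝔸.Hole} {i : I}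
    (hh : h ∈ (sub i).holes) : h ∉ Q.holes :=
  Set.disjoint_right.1 F.disjoint ⟨Or.inr (Set.mem_iUnion.2 ⟨i, hh⟩), F.ne_of_mem_sub hh⟩

theorem holeConditions_fill (F : FillConditions sub J sort SV j₀ Q) :
    HoleConditions (fun o => (fillSub Q sub o).holes) (J \ {j₀})
      (fun j => sort ⟨j.1, j.2.1⟩) (fun k => (SV k).fill j₀) where
  disjoint o := by
    cases o with
    | none => exact F.disjoint.mono_right (Set.sdiff_subset_sdiff_left Set.subset_union_left)
    | some i => exact (F.hole.disjoint i).mono_right Set.sdiff_subset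
  pairwise o o' hne := by
    have key : ∀ i, Disjoint Q.holes (sub i).holes := fun i =>
      Set.disjoint_right.2 fun _ hh => F.notMem_of_mem_sub hh
    cases o with
    | none =>
      cases o' with
      | none => exact absurd rfl hne
      | some i' => exact key i'
    | some i =>
      cases o' with
      | none => exact (key i).symm
      | some i' => exact F.hole.pairwise i i' (fun h => hne (congrArg some h))
  sig_mem k j a ha := by
    by_cases hj : j = j₀
    · simp [SyncVec.fill, hj] at ha
    · have ha' : (SV k).hole j = some a := by simpa [SyncVec.fill, hj] using ha
      obtain ⟨hJ, hs⟩ := F.hole.sig_mem k j a ha'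
      exact ⟨⟨hJ, hj⟩, hs⟩

end PNet.FillConditions

variable {sv : SyncVec 𝔸 I} {ν : 𝔸.LocalVar → 𝔸.Val}

theorem GroundNode.of_fill (F : PNet.FillConditions sub J sort SV j₀ Q)
    {β : Option I → 𝔸.Hole → Option 𝔸.GroundAct}
    {s s' : (o : Option I) → (PNet.fillSub Q sub o).State}
    {ρ ρ' : (Σ o, (PNet.fillSub Q sub o).Vars) → 𝔸.Val} {b : 𝔸.Hole → Option 𝔸.GroundAct}
    {a : 𝔸.GroundAct}
    (hg : GroundNode (fun o => (PNet.fillSub Q sub o).holes) (fun o => (PNet.fillSub Q sub o).trans)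
      (J \ {j₀}) (sv.fill j₀) ν β s ρ b a s' ρ') :
    GroundMove Q.trans ((sv.hole j₀).map (Act.eval ν)) (fillState.inner s) (fillVal.inner ρ)
      (β none) (fillState.inner s') (fillVal.inner ρ') ∧
    ∃ bP, GroundNode (fun i => (sub i).holes) (fun i => (sub i).trans) J sv ν (fun i => β (some i))
        (fillState.outer s) (fillVal.outer ρ) bP a (fillState.outer s') (fillVal.outer ρ') ∧
      b = mergeHoles Q.holes j₀ none (β none) bP := by
  classical
  -- Here `j₀` is tested before `Q.holes`: even if `Q` reuses this name, the action of `P` at `j₀`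
  -- is the one in the vector. The other holes of `Q` are not holes of `P`.
  refine ⟨hg.move none, fun h => if h = j₀ then (sv.hole j₀).map (Act.eval ν) else
    if h ∈ Q.holes then none else b h, ⟨fun i => hg.move (some i), fun j hj => ?_,
    fun i h hh => ?_, fun h hJ hI => ?_, hg.act, hg.guard⟩, ?_⟩
  · by_cases hj₀ : j = j₀
    · simp [hj₀]
    · have := hg.hole j ⟨hj, hj₀⟩
      simpa [hj₀, F.notMem_of_mem_J hj hj₀, SyncVec.fill] using this
  · simpa [F.ne_of_mem_sub hh, F.notMem_of_mem_sub hh] using hg.subHole (some i) h hh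
  · have hne : h ≠ j₀ := fun he => hJ (he ▸ F.mem)
    by_cases hQ : h ∈ Q.holes
    · simp [hne, hQ]
    · simp only [hne, hQ, if_false]
      refine hg.noHole h (fun hh => hJ hh.1) fun o => ?_
      cases o with
      | none => exact hQ
      | some i => exact hI i
  · funext h
    by_cases hQ : h ∈ Q.holes
    · simpa [mergeHoles, hQ] using hg.subHole none h hQ
    · by_cases hne : h = j₀
      · rw [mergeHoles, if_neg hQ, if_pos hne]
        refine hg.noHole h (fun hh => hh.2 hne) fun o => ?_
        cases o with
        | none => exact hQ
        | some i => exact fun hh => F.ne_of_mem_sub hh hne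
      · simp [mergeHoles, hQ, hne]

/-- Converse of `GroundNode.of_fill`. The vector and `ν` are kept, so `Q` has to make exactly the
action `b j₀`. -/
theorem GroundNode.fill (F : PNet.FillConditions sub J sort SV j₀ Q)
    {β : I → 𝔸.Hole → Option 𝔸.GroundAct} {βQ : 𝔸.Hole → Option 𝔸.GroundAct}
    {q q' : Q.State} {σ σ' : Q.Vars → 𝔸.Val} {s s' : (i : I) → (sub i).State}
    {ρ ρ' : (Σ i, (sub i).Vars) → 𝔸.Val} {b : 𝔸.Hole → Option 𝔸.GroundAct} {a : 𝔸.GroundAct}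
    (hg : GroundNode (fun i => (sub i).holes) (fun i => (sub i).trans) J sv ν β s ρ b a s' ρ')
    (hQ : GroundMove Q.trans (b j₀) q σ βQ q' σ') :
    GroundNode (fun o => (PNet.fillSub Q sub o).holes) (fun o => (PNet.fillSub Q sub o).trans)
      (J \ {j₀}) (sv.fill j₀) ν (fun o => o.elim βQ β) (fillState q s) (fillVal σ ρ)
      (mergeHoles Q.holes j₀ none βQ b) a (fillState q' s') (fillVal σ' ρ') := by
  refine ⟨fun o => ?_, fun j hj => ?_, fun o h hh => ?_, fun h hJ hI => ?_, hg.act, hg.guard⟩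
  · cases o with
    | none =>
      rw [hg.hole j₀ F.mem] at hQ
      exact hQ
    | some i => exact hg.move i
  · have hj₀ : j ≠ j₀ := hj.2
    simpa [mergeHoles, hj₀, F.notMem_of_mem_J hj.1 hj₀, SyncVec.fill] using hg.hole j hj.1
  · cases o with
    | none =>
      have hh : h ∈ Q.holes := hh
      simp [mergeHoles, hh]
    | some i =>
      have hh : h ∈ (sub i).holes := hh
      simpa [mergeHoles, F.ne_of_mem_sub hh, F.notMem_of_mem_sub hh] using hg.subHole i h hh
  · have hQh : h ∉ Q.holes := hI none
    by_cases hne : h = j₀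
    · rw [mergeHoles, if_neg hQh, if_pos hne]
    · simpa [mergeHoles, hQh, hne] using hg.noHole h (fun hh => hJ ⟨hh, hne⟩) (fun i => hI (some i))

/-- A step of a node in which the hole `j₀` makes a silent action does nothing else. -/
theorem GroundNode.eq_of_silent (F : PNet.FillConditions sub J sort SV j₀ Q) {k : K}
    {β : I → 𝔸.Hole → Option 𝔸.GroundAct} {s s' : (i : I) → (sub i).State}
    {ρ ρ' : (Σ i, (sub i).Vars) → 𝔸.Val} {b : 𝔸.Hole → Option 𝔸.GroundAct} {a : 𝔸.GroundAct}
    (hg : GroundNode (fun i => (sub i).holes) (fun i => (sub i).trans) J (SV k) ν β s ρ b a s' ρ')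
    (hb : b j₀ = some 𝔸.groundTau) :
    s' = s ∧ ρ' = ρ ∧ a = 𝔸.groundTau ∧ ∀ h, h ≠ j₀ → b h = none := by
  rw [hg.hole j₀ F.mem, Option.map_eq_some_iff] at hb
  obtain ⟨α, hα, hτ⟩ := hb
  -- A component that evaluates to `τ` is literally `τ`, which is the form `tau_only` speaks of.
  rw [Act.eval_eq_groundTau.1 hτ] at hα
  obtain ⟨hact, hsub, hhole⟩ := F.tau_only k hα
  have hidle : ∀ i, s' i = s i ∧ (fun v => ρ' ⟨i, v⟩) = (fun v => ρ ⟨i, v⟩) ∧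
      ∀ h, β i h = none := by
    intro i
    rcases hg.move i with ⟨c, hc, -⟩ | ⟨-, h⟩
    · rw [hsub i] at hc
      cases hc
    · exact h
  refine ⟨funext fun i => (hidle i).1, funext fun v => congrFun (hidle v.1).2.1 v.2,
    by rw [hg.act, hact, Act.eval_silent], fun h hne => ?_⟩
  by_cases hJ : h ∈ J
  · rw [hg.hole h hJ, hhole h hne]
    rfl
  · by_cases hI : ∃ i, h ∈ (sub i).holes
    · obtain ⟨i, hi⟩ := hI
      rw [hg.subHole i h hi, (hidle i).2.2 h]
    · exact hg.noHole h hJ (by simpa using hI)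

theorem GroundStep.fill (F : PNet.FillConditions sub J sort SV j₀ Q)
    {βQ : 𝔸.Hole → Option 𝔸.GroundAct} {q q' : Q.State} {σ σ' : Q.Vars → 𝔸.Val}
    {s s' : (i : I) → (sub i).State} {ρ ρ' : (Σ i, (sub i).Vars) → 𝔸.Val}
    {b : 𝔸.Hole → Option 𝔸.GroundAct} {a : 𝔸.GroundAct}
    (h : GroundStep (PNet.nodeTrans sub J sort SV) s ρ b a s' ρ')
    (hQ : GroundMove Q.trans (b j₀) q σ βQ q' σ') :
    GroundStep (PNet.fillTrans sub J sort SV j₀ Q) (fillState q s)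
      (fillVal σ ρ) (mergeHoles Q.holes j₀ none βQ b) a (fillState q' s') (fillVal σ' ρ') := by
  obtain ⟨k, ν, β, hg⟩ := (groundStep_node_iff F.hole).1 h
  exact (groundStep_node_iff F.holeConditions_fill).2 ⟨k, ν, _, hg.fill F hQ⟩

/-! ### Lifting weak steps of `P` to `P[Q]`. -/

theorem mergeHoles_append (H : Set 𝔸.Hole) (j₀ : 𝔸.Hole)
    (f f₁ f₂ f₃ γ₁ γ₂ γ₃ : 𝔸.Hole → List 𝔸.GroundAct) (hf : ∀ h, f h = f₁ h ++ f₂ h ++ f₃ h) :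
    mergeHoles H j₀ [] f (fun h => γ₁ h ++ γ₂ h ++ γ₃ h) = fun h =>
      mergeHoles H j₀ [] f₁ γ₁ h ++ mergeHoles H j₀ [] f₂ γ₂ h ++ mergeHoles H j₀ [] f₃ γ₃ h := by
  funext h
  unfold mergeHoles
  split_ifs
  · exact hf h
  · rfl
  · rfl

/-- Weak steps of `P` that do not involve the hole `j₀`, lifted to `P[Q]_{j₀}`. -/
theorem GroundWeak.fill_idle (F : PNet.FillConditions sub J sort SV j₀ Q) (q : Q.State)
    (σ : Q.Vars → 𝔸.Val) {s s' : (i : I) → (sub i).State} {ρ ρ' : (Σ i, (sub i).Vars) → 𝔸.Val}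
    {γ : 𝔸.Hole → List 𝔸.GroundAct} {a : 𝔸.GroundAct}
    (h : GroundWeak (PNet.nodeTrans sub J sort SV) s ρ γ a s' ρ')
    (hγ : γ j₀ = []) :
    GroundWeak (PNet.fillTrans sub J sort SV j₀ Q) (fillState q s)
      (fillVal σ ρ) (mergeHoles Q.holes j₀ [] (fun _ => []) γ) a (fillState q s')
      (fillVal σ ρ') := by
  induction h with
  | stay s ρ =>
    have : mergeHoles Q.holes j₀ [] (fun _ => []) (fun _ => []) =
        fun _ => ([] : List 𝔸.GroundAct) := by
      funext h
      simp [mergeHoles]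
    rw [this]
    exact GroundWeak.stay _ _
  | @step s s' ρ ρ' b a h =>
    rcases groundVisible_eq_nil.1 hγ with hb | hb
    · have := GroundWeak.step (h.fill F (q := q) (σ := σ) (q' := q) (σ' := σ)
        (βQ := fun _ => none) (Or.inr ⟨hb, rfl, rfl, fun _ => rfl⟩))
      rwa [groundVisible_mergeHoles] at this
    -- An idle `Q` cannot supply the `τ` expected at `j₀`, but the step has no effect and is
    -- replaced by `stay`.
    · obtain ⟨k, ν, β, hg⟩ := (groundStep_node_iff F.hole).1 h
      obtain ⟨rfl, rfl, rfl, hn⟩ := hg.eq_of_silent F hb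
      have : mergeHoles Q.holes j₀ [] (fun _ => []) (fun h => groundVisible (b h)) =
          fun _ => ([] : List 𝔸.GroundAct) := by
        funext h
        by_cases hne : h = j₀
        · simp [mergeHoles, hne]
        · simp [mergeHoles, hn h hne, groundVisible]
      rw [this]
      exact GroundWeak.stay _ _
  | seq _ _ _ ih₁ ih₂ ih₃ =>
    simp only [List.append_eq_nil_iff] at hγ
    rw [mergeHoles_append (f := fun _ => []) (f₁ := fun _ => []) (f₂ := fun _ => [])
      (f₃ := fun _ => []) (hf := fun _ => rfl)]
    exact GroundWeak.seq (ih₁ hγ.1.1) (ih₂ hγ.1.2) (ih₃ hγ.2)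

/-- Weak steps of `P` in which the hole `j₀` makes one visible action, synchronised with a step of
`Q`. -/
theorem GroundWeak.fill_step (F : PNet.FillConditions sub J sort SV j₀ Q) {q q' : Q.State}
    {σ σ' : Q.Vars → 𝔸.Val} {βQ : 𝔸.Hole → Option 𝔸.GroundAct} {c : 𝔸.GroundAct}
    (hQ : GroundStep Q.trans q σ βQ c q' σ') {s s' : (i : I) → (sub i).State}
    {ρ ρ' : (Σ i, (sub i).Vars) → 𝔸.Val} {γ : 𝔸.Hole → List 𝔸.GroundAct} {a : 𝔸.GroundAct}
    (h : GroundWeak (PNet.nodeTrans sub J sort SV) s ρ γ a s' ρ')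
    (hγ : γ j₀ = [c]) :
    GroundWeak (PNet.fillTrans sub J sort SV j₀ Q) (fillState q s)
      (fillVal σ ρ) (mergeHoles Q.holes j₀ [] (fun h => groundVisible (βQ h)) γ) a
      (fillState q' s') (fillVal σ' ρ') := by
  induction h with
  | stay s ρ => cases hγ
  | @step s s' ρ ρ' b a h =>
    have := GroundWeak.step (h.fill F (Or.inl ⟨c, groundVisible_eq_singleton hγ, hQ⟩))
    rwa [groundVisible_mergeHoles] at this
  | seq h₁ h₂ h₃ ih₁ ih₂ ih₃ =>
    -- Exactly one of the three segments contains `c`. `Q` moves in that one, and rests in `q`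
    -- before it and in `q'` after it.
    rcases List.append_eq_singleton_iff.1 hγ with ⟨h₁₂, hc⟩ | ⟨h₁₂, hn⟩
    · rw [List.append_eq_nil_iff] at h₁₂
      rw [mergeHoles_append (f := fun h => groundVisible (βQ h)) (f₁ := fun _ => []) (f₂ := fun _ => [])
        (f₃ := fun h => groundVisible (βQ h)) (hf := fun _ => rfl)]
      exact GroundWeak.seq (h₁.fill_idle F q σ h₁₂.1) (h₂.fill_idle F q σ h₁₂.2) (ih₃ hc)
    · rcases List.append_eq_singleton_iff.1 h₁₂ with ⟨hn₁, hc⟩ | ⟨hc, hn₂⟩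
      · rw [mergeHoles_append (f := fun h => groundVisible (βQ h)) (f₁ := fun _ => []) (f₂ := fun h => groundVisible (βQ h))
          (f₃ := fun _ => []) (hf := fun _ => by simp)]
        exact GroundWeak.seq (h₁.fill_idle F q σ hn₁) (ih₂ hc) (h₃.fill_idle F q' σ' hn)
      · rw [mergeHoles_append (f := fun h => groundVisible (βQ h)) (f₁ := fun h => groundVisible (βQ h)) (f₂ := fun _ => [])
          (f₃ := fun _ => []) (hf := fun _ => by simp)]
        exact GroundWeak.seq (ih₁ hc) (h₂.fill_idle F q' σ' hn₂) (h₃.fill_idle F q' σ' hn)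

/-- A silent step of `Q` is a step of `P[Q]_{j₀}`. -/
theorem GroundStep.fill_silent (F : PNet.FillConditions sub J sort SV j₀ Q) {q q' : Q.State}
    {σ σ' : Q.Vars → 𝔸.Val} {βQ : 𝔸.Hole → Option 𝔸.GroundAct}
    (hQ : GroundStep Q.trans q σ βQ 𝔸.groundTau q' σ') (s : (i : I) → (sub i).State)
    (ρ : (Σ i, (sub i).Vars) → 𝔸.Val) :
    GroundStep (PNet.fillTrans sub J sort SV j₀ Q) (fillState q s)
      (fillVal σ ρ) (mergeHoles Q.holes j₀ none βQ (fun _ => none)) 𝔸.groundTau (fillState q' s)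
      (fillVal σ' ρ) := by
  classical
  obtain ⟨k, hsub, hhole, hact, hguard⟩ := F.exists_tau
  let b : 𝔸.Hole → Option 𝔸.GroundAct := fun h => if h = j₀ then some 𝔸.groundTau else none
  have hg : GroundStep (PNet.nodeTrans sub J sort SV) s ρ b 𝔸.groundTau s ρ := by
    -- The only component of this vector is `τ` and its guard always holds, so the values of its
    -- variables are arbitrary.
    refine (groundStep_node_iff F.hole).2 ⟨k, fun _ => 𝔸.tt, fun _ _ => none, fun i => ?_,
      fun j _ => ?_, fun i h hh => if_neg (F.ne_of_mem_sub hh),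
      fun h hJ _ => if_neg fun he : h = j₀ => hJ (he ▸ F.mem), by rw [hact, Act.eval_silent], hguard _⟩
    · rw [hsub i]
      exact Or.inr ⟨rfl, rfl, rfl, fun _ => rfl⟩
    · rcases hhole j with ⟨h, rfl⟩ | ⟨h, hne⟩
      · simp [b, h, Act.eval_silent]
      · simp [b, h, hne]
  have := hg.fill F (Or.inl ⟨_, if_pos rfl, hQ⟩)
  have hb : mergeHoles Q.holes j₀ none βQ b = mergeHoles Q.holes j₀ none βQ (fun _ => none) := by
    funext h
    unfold mergeHoles
    split_ifs with h₁ h₂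
    · rfl
    · rfl
    · exact if_neg h₂
  rwa [hb] at this

/-! ### The induced relation is a simulation. -/

/-- The relation between the states of `P[Q]_{j₀}` and `P'[Q]_{j₀}` induced by a relation between
the states of `P` and `P'`. -/
def fillRel (Q : PNet 𝔸) {sub : I → PNet 𝔸} {sub' : I' → PNet 𝔸}
    (R : ((i : I) → (sub i).State) → ((i : I') → (sub' i).State) →
      ((Σ i, (sub i).Vars) → 𝔸.Val) → ((Σ i, (sub' i).Vars) → 𝔸.Val) → Prop)
    (s : (o : Option I) → (PNet.fillSub Q sub o).State)
    (t : (o : Option I') → (PNet.fillSub Q sub' o).State)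
    (ρ₁ : (Σ o, (PNet.fillSub Q sub o).Vars) → 𝔸.Val)
    (ρ₂ : (Σ o, (PNet.fillSub Q sub' o).Vars) → 𝔸.Val) : Prop :=
  fillState.inner s = fillState.inner t ∧ fillVal.inner ρ₁ = fillVal.inner ρ₂ ∧
    R (fillState.outer s) (fillState.outer t) (fillVal.outer ρ₁) (fillVal.outer ρ₂)

theorem GroundSimulation.fill (F : PNet.FillConditions sub J sort SV j₀ Q)
    (F' : PNet.FillConditions sub' J sort SV' j₀ Q)
    {R : ((i : I) → (sub i).State) → ((i : I') → (sub' i).State) →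
      ((Σ i, (sub i).Vars) → 𝔸.Val) → ((Σ i, (sub' i).Vars) → 𝔸.Val) → Prop}
    (hR : GroundSimulation (PNet.nodeTrans sub J sort SV) (PNet.nodeTrans sub' J sort SV') R) :
    GroundSimulation (PNet.fillTrans sub J sort SV j₀ Q) (PNet.fillTrans sub' J sort SV' j₀ Q)
      (fillRel Q R) := by
  intro s t ρ₁ ρ₂ b a s' ρ₁' ⟨hq, hσ, hst⟩ hstep
  obtain ⟨k, ν, β, hg⟩ := (groundStep_node_iff F.holeConditions_fill).1 hstep
  obtain ⟨hmove, bP, hgP, rfl⟩ := hg.of_fill F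
  -- The move of `Q` is now expressed by the action of `P` at `j₀`, which is what the answer of `P'`
  -- is compared with.
  rw [← hgP.hole j₀ F.mem] at hmove
  rw [groundVisible_mergeHoles]
  have hP : GroundStep (PNet.nodeTrans sub J sort SV) _ _ bP a _ _ :=
    (groundStep_node_iff F.hole).2 ⟨k, ν, _, hgP⟩
  rcases hmove with ⟨c, hc, hQ⟩ | ⟨hn, hs, hρ, hβ⟩
  · rw [hq, hσ] at hQ
    -- A silent `c` is erased from the answer given by `R`, which would leave `Q` behind. In that
    -- case `R` is not used to find an answer: `P` has not moved, and `P'` stays where it is.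
    by_cases hτ : c = 𝔸.groundTau
    · subst hτ
      obtain ⟨hs, hρ, rfl, hb⟩ := hgP.eq_of_silent F hc
      have := GroundWeak.step (hQ.fill_silent F' (fillState.outer t) (fillVal.outer ρ₂))
      rw [fillState_eta t, fillVal_eta ρ₂] at this
      have hγ : (fun h => groundVisible (mergeHoles Q.holes j₀ none (β none) (fun _ => none) h)) =
          mergeHoles Q.holes j₀ [] (fun h => groundVisible (β none h))
            (fun h => groundVisible (bP h)) := by
        funext h
        unfold mergeHoles
        split_ifs with h₁ h₂
        · rfl
        · rfl
        · exact congrArg groundVisible (hb h h₂).symm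
      rw [hγ] at this
      rw [← hs, ← hρ] at hst
      exact ⟨_, _, this, rfl, rfl, hst⟩
    · obtain ⟨t', ρ₂', hw, hR'⟩ := hR _ _ _ _ _ _ _ _ hst hP
      have := hw.fill_step F' hQ (by simp [hc, groundVisible, hτ])
      rw [fillState_eta t, fillVal_eta ρ₂] at this
      exact ⟨_, _, this, rfl, rfl, hR'⟩
  · obtain ⟨t', ρ₂', hw, hR'⟩ := hR _ _ _ _ _ _ _ _ hst hP
    have := hw.fill_idle F' (fillState.inner t) (fillVal.inner ρ₂) (by simp [hn, groundVisible])
    rw [fillState_eta t, fillVal_eta ρ₂] at this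
    have hβ' : (fun h => groundVisible (β none h)) = fun _ => [] := by
      funext h
      rw [hβ h]
      rfl
    rw [hβ']
    exact ⟨_, _, this, hs.trans hq, hρ.trans hσ, hR'⟩
-- The second half of the bisimulation concerns the swapped relation, and `fillRel` commutes with
-- swapping because equality of the `Q` components is symmetric.
theorem GroundSimulation.fill_swap (F : PNet.FillConditions sub J sort SV j₀ Q)
    (F' : PNet.FillConditions sub' J sort SV' j₀ Q)
    {R : ((i : I) → (sub i).State) → ((i : I') → (sub' i).State) →
      ((Σ i, (sub i).Vars) → 𝔸.Val) → ((Σ i, (sub' i).Vars) → 𝔸.Val) → Prop}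
    (hR : GroundSimulation (PNet.nodeTrans sub' J sort SV') (PNet.nodeTrans sub J sort SV)
      (fun t s ρ₂ ρ₁ => R s t ρ₁ ρ₂)) :
    GroundSimulation (PNet.fillTrans sub' J sort SV' j₀ Q) (PNet.fillTrans sub J sort SV j₀ Q)
      (fun t s ρ₂ ρ₁ => fillRel Q R s t ρ₁ ρ₂) := by
  have hswap : (fun t s ρ₂ ρ₁ => fillRel Q R s t ρ₁ ρ₂) =
      fillRel Q (fun t s ρ₂ ρ₁ => R s t ρ₁ ρ₂) := by
    funext t s ρ₂ ρ₁
    exact propext (and_congr eq_comm (and_congr eq_comm Iff.rfl))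
  rw [hswap]
  exact hR.fill F' F

end Fill

/-! ### Congruence -/

section Congruence

variable {𝔸 : TermAlgebra.{u}} {I I' K K' : Type u} {J : Set 𝔸.Hole} {sort : J → Set 𝔸.Signature}

theorem PNet.mem_holes_of_mem_holeSort (P : PNet 𝔸) {h : 𝔸.Hole} {σ : 𝔸.Signature}
    (hσ : σ ∈ P.holeSort h) : h ∈ P.holes := by
  induction P with
  | lts L => exact absurd hσ (Set.notMem_empty σ)
  | node I sub J sort K SV ih =>
    rcases hσ with ⟨hj, -⟩ | ⟨i, hi⟩
    · exact Or.inl hj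
    · exact Or.inr (Set.mem_iUnion.2 ⟨i, ih i hi⟩)

theorem PNet.fillConditions {sub : I → PNet 𝔸} {SV : K → SyncVec 𝔸 I} {j₀ : 𝔸.Hole} {Q : PNet 𝔸}
    (wf : (PNet.node I sub J sort K SV).WellFormed)
    (hobs : (PNet.node I sub J sort K SV).CannotObserveSilent) (hj₀ : j₀ ∈ J)
    (hholes : Disjoint Q.holes ((PNet.node I sub J sort K SV).holes \ {j₀})) :
    FillConditions sub J sort SV j₀ Q where
  hole := ⟨wf.2.2.2.1, wf.2.2.2.2.1, fun k => (wf.2.2.2.2.2 k).2.1⟩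
  mem := hj₀
  disjoint := hholes
  exists_tau := hobs.2.1 j₀ hj₀
  tau_only := fun k => hobs.2.2 k j₀ hj₀

theorem PNet.mem_holes_fill {sub : I → PNet 𝔸} {SV : K → SyncVec 𝔸 I} {j₀ : 𝔸.Hole} {Q : PNet 𝔸}
    (F : FillConditions sub J sort SV j₀ Q) (h : 𝔸.Hole) :
    h ∈ ((PNet.node I sub J sort K SV).fill j₀ Q).holes ↔
      h ∈ Q.holes ∨ h ≠ j₀ ∧ h ∈ (PNet.node I sub J sort K SV).holes := by
  constructor
  · rintro (⟨hJ, hne⟩ | hU)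
    · exact Or.inr ⟨hne, Or.inl hJ⟩
    · obtain ⟨o, ho⟩ := Set.mem_iUnion.1 hU
      cases o with
      | none => exact Or.inl ho
      | some i => exact Or.inr ⟨F.ne_of_mem_sub ho, Or.inr (Set.mem_iUnion.2 ⟨i, ho⟩)⟩
  · rintro (hQ | ⟨hne, hJ | hU⟩)
    · exact Or.inr (Set.mem_iUnion.2 ⟨none, hQ⟩)
    · exact Or.inl ⟨hJ, hne⟩
    · obtain ⟨i, hi⟩ := Set.mem_iUnion.1 hU
      exact Or.inr (Set.mem_iUnion.2 ⟨some i, hi⟩)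

theorem PNet.mem_holeSort_fill {sub : I → PNet 𝔸} {SV : K → SyncVec 𝔸 I} {j₀ : 𝔸.Hole} {Q : PNet 𝔸}
    (F : FillConditions sub J sort SV j₀ Q) (h : 𝔸.Hole) (σ : 𝔸.Signature) :
    σ ∈ ((PNet.node I sub J sort K SV).fill j₀ Q).holeSort h ↔
      σ ∈ Q.holeSort h ∨ h ≠ j₀ ∧ σ ∈ (PNet.node I sub J sort K SV).holeSort h := by
  constructor
  · rintro (⟨⟨hJ, hne⟩, hs⟩ | ⟨o, ho⟩)
    · exact Or.inr ⟨hne, Or.inl ⟨hJ, hs⟩⟩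
    · cases o with
      | none => exact Or.inl ho
      | some i =>
        exact Or.inr ⟨F.ne_of_mem_sub ((sub i).mem_holes_of_mem_holeSort ho), Or.inr ⟨i, ho⟩⟩
  · rintro (hQ | ⟨hne, ⟨hJ, hs⟩ | ⟨i, hi⟩⟩)
    · exact Or.inr ⟨none, hQ⟩
    · exact Or.inl ⟨⟨hJ, hne⟩, hs⟩
    · exact Or.inr ⟨some i, hi⟩

end Congruence

theorem mainTheorem5 {𝔸 : TermAlgebra.{u}} {I I' K K' : Type u}
    (J : Set 𝔸.Hole) (sort : J → Set 𝔸.Signature)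
    (sub : I → PNet 𝔸) (SV : K → SyncVec 𝔸 I)
    (sub' : I' → PNet 𝔸) (SV' : K' → SyncVec 𝔸 I')
    (P P' Q : PNet 𝔸)
    (hP : P = PNet.node I sub J sort K SV)
    (hP' : P' = PNet.node I' sub' J sort K' SV')
    (wfP : P.WellFormed) (wfP' : P'.WellFormed) (wfQ : Q.WellFormed)
    (hbisim : P.WeakFHBisimilar P')
    (hobs : P.CannotObserveSilent) (hobs' : P'.CannotObserveSilent)
    (j₀ : 𝔸.Hole) (hj₀ : j₀ ∈ J)
    (hsort : Q.sortOf = sort ⟨j₀, hj₀⟩)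
    -- the compositions are pNets: no clash of hole indexes or of variables
    (hholes : Disjoint Q.holes (P.holes \ {j₀}))
    (hvars : Disjoint Q.vars P.vars) (hvars' : Disjoint Q.vars P'.vars) :
    (P.fill j₀ Q).WeakFHBisimilar (P'.fill j₀ Q) := by
  subst hP hP'
  obtain ⟨heq, hsrt, R, ⟨hR, hR'⟩, hinit⟩ := hbisim
  replace heq : (PNet.node I sub J sort K SV).holes = (PNet.node I' sub' J sort K' SV').holes := heq
  have F := PNet.fillConditions wfP hobs hj₀ hholes
  have F' := PNet.fillConditions wfP' hobs' hj₀ (heq ▸ hholes)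
  -- Initially both copies of `Q` are in the same state and read the same variable names from `ρ`,
  -- hence the two `rfl`.
  refine ⟨?_, ?_, fillRel Q R,
    ⟨weakSimulation_iff.2 ((weakSimulation_iff.1 hR).fill F F'),
      weakSimulation_iff.2 ((weakSimulation_iff.1 hR').fill_swap F F')⟩, fun ρ => ⟨rfl, rfl, hinit ρ⟩⟩
  · ext h
    exact (PNet.mem_holes_fill F h).trans (heq ▸ (PNet.mem_holes_fill F' h).symm)
  · intro h _
    ext σ
    refine (PNet.mem_holeSort_fill F h σ).trans
      (Iff.trans ?_ (PNet.mem_holeSort_fill F' h σ).symm)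
    refine or_congr_right (and_congr_right fun _ => ?_)
    -- `hsrt` covers only the holes of `P`. At any other index, such as a hole coming from `Q`
    -- alone, both sorts are empty.
    by_cases hh : h ∈ (PNet.node I sub J sort K SV).holes
    · exact Set.ext_iff.1 (hsrt h hh) σ
    · exact ⟨fun hs => absurd (PNet.mem_holes_of_mem_holeSort _ hs) hh,
        fun hs => absurd (heq ▸ PNet.mem_holes_of_mem_holeSort _ hs) hh⟩
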